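/- Let $\Omega\subset\mathbb R^m$ be an open (possibly unbounded) set with Lipschitz boundary, meaning that near each of its boundary points $\Omega$ is, after a rotation, the set of points lying strictly above the graph of a Lipschitz function of $m-1$ variables. Let $\varphi:[0,\infty)\to[0,\infty)$ be concave with $\varphi(0)=0$, and suppose that $\varphi^\infty:=\lim_{t\to\infty}\varphi(t)/t$ satisfies $0<\varphi^\infty<\infty$. For $u\in \mathrm{BV}(\Omega)$, i.e. $u\in L^1(\Omega)$ whose distributional gradient $Du$ is a finite $\mathbb R^m$-valued Radon measure on $\Omega$, put $\mathrm{TV}(u):=|Du|(\Omega)$, where $|Du|$ is the total variation measure of $Du$. A sequence $u^i\in\mathrm{BV}(\Omega)$ converges weakly* to $u$ in $\mathrm{BV}(\Omega)$ if $u^i\to u$ strongly in $L^1(\Omega)$ and $\int_\Omega\psi\cdot dDu^i\to\int_\Omega\psi\cdot dDu$ for every $\psi\in C_0(\Omega;\mathbb R^m)$ (continuous fields on $\Omega$ for which $\{x\in\Omega:|\psi(x)|\ge\varepsilon\}$ is compact for every $\varepsilon>0$). Define the relaxed continuous model by $$\mathrm{TV}^\varphi_c(u):=\inf\Big\{\liminf_{i\to\infty}\int_\Omega\varphi(|\nabla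 u^i(x)|)\,dx \;:\; u^i\in C^1(\Omega)\cap\mathrm{BV}(\Omega),\ u^i\to u\text{ weakly* in }\mathrm{BV}(\Omega)\Big\}\in[0,\infty].$$ Then $$\mathrm{TV}^\varphi_c(u)=\varphi^\infty\,\mathrm{TV}(u)\qquad\text{for all } u\in\mathrm{BV}(\Omega).$$ -/

import Mathlib

open MeasureTheory Filter Topology Set
open scoped ENNReal NNReal

noncomputable section

/-- `Ω` has a Lipschitz boundary: near each boundary point, after a rotation, `Ω` is the set of
points lying strictly above the graph of a Lipschitz function of `m - 1` variables.
Here `e` is the vertical direction, `inner ℝ e x` the height of `x`, and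
`x - inner ℝ e x • e` the orthogonal projection of `x` to the hyperplane `e^⊥`. -/
def HasLipschitzBoundary {m : ℕ} (Ω : Set (EuclideanSpace ℝ (Fin m))) : Prop :=
  ∀ p ∈ frontier Ω, ∃ U : Set (EuclideanSpace ℝ (Fin m)), IsOpen U ∧ p ∈ U ∧
    ∃ e : EuclideanSpace ℝ (Fin m), ‖e‖ = 1 ∧
      ∃ (K : ℝ≥0) (γ : EuclideanSpace ℝ (Fin m) → ℝ), LipschitzWith K γ ∧
        Ω ∩ U = {x | γ (x - (inner ℝ e x : ℝ) • e) < inner ℝ e x} ∩ U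

/-- The divergence of a vector field. -/
def divergence {m : ℕ} (ψ : EuclideanSpace ℝ (Fin m) → EuclideanSpace ℝ (Fin m))
    (x : EuclideanSpace ℝ (Fin m)) : ℝ :=
  ∑ i, (fderiv ℝ ψ x (EuclideanSpace.single i 1)) i

/-- The integral `∫ ψ · dμ` of a vector field against an `ℝ^m`-valued measure, the pairing being
the Euclidean inner product. -/
def pairing {m : ℕ} (μ : VectorMeasure (EuclideanSpace ℝ (Fin m)) (EuclideanSpace ℝ (Fin m)))
    (ψ : EuclideanSpace ℝ (Fin m) → EuclideanSpace ℝ (Fin m)) : ℝ :=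
  ∫ᵛ x, ψ x ∂[innerSL ℝ; μ]

/-- `μ` is a finite `ℝ^m`-valued Radon measure on `Ω` which represents the distributional gradient
of `u` on `Ω`: `∫_Ω u div ψ dx = - ∫ ψ · dμ` for all `ψ ∈ C_c^∞(Ω; ℝ^m)`. (On an open subset of
`ℝ^m`, finite Borel measures are Radon.) -/
structure IsDistribGradient {m : ℕ} (Ω : Set (EuclideanSpace ℝ (Fin m)))
    (u : EuclideanSpace ℝ (Fin m) → ℝ)
    (μ : VectorMeasure (EuclideanSpace ℝ (Fin m)) (EuclideanSpace ℝ (Fin m))) : Prop where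
  finite : μ.variation univ < ⊤
  concentrated : μ.restrict Ω = μ
  integral_div : ∀ ψ : EuclideanSpace ℝ (Fin m) → EuclideanSpace ℝ (Fin m),
    ContDiff ℝ (⊤ : ℕ∞) ψ → HasCompactSupport ψ → tsupport ψ ⊆ Ω →
      ∫ x in Ω, u x * divergence ψ x = - pairing μ ψ

/-- `u ∈ BV(Ω)`. Functions are given on all of `ℝ^m`, but only their values on `Ω` matter. -/
def IsBV {m : ℕ} (Ω : Set (EuclideanSpace ℝ (Fin m))) (u : EuclideanSpace ℝ (Fin m) → ℝ) : Prop :=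
  IntegrableOn u Ω volume ∧ ∃ μ, IsDistribGradient Ω u μ

open Classical in
/-- The distributional gradient `Du` of `u ∈ BV(Ω)`, as an `ℝ^m`-valued measure
(`0` if `u` is not of bounded variation). -/
def distribGradient {m : ℕ} (Ω : Set (EuclideanSpace ℝ (Fin m)))
    (u : EuclideanSpace ℝ (Fin m) → ℝ) :
    VectorMeasure (EuclideanSpace ℝ (Fin m)) (EuclideanSpace ℝ (Fin m)) :=
  if h : ∃ μ, IsDistribGradient Ω u μ then h.choose else 0

/-- `TV(u) = |Du|(Ω)`, the mass of the total variation measure of `Du`. -/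
def TV {m : ℕ} (Ω : Set (EuclideanSpace ℝ (Fin m))) (u : EuclideanSpace ℝ (Fin m) → ℝ) : ℝ≥0∞ :=
  (distribGradient Ω u).variation Ω

/-- Weak* convergence `v i ⇀* u` in `BV(Ω)`: all the functions are in `BV(Ω)`, `v i → u` strongly
in `L¹(Ω)`, and `D(v i) ⇀* Du` weakly* as measures on `Ω`, i.e. tested with all
`ψ ∈ C₀(Ω; ℝ^m)` (identified with the continuous fields on `ℝ^m` which vanish off `Ω` and at
infinity). -/
structure WeakStarBV {m : ℕ} (Ω : Set (EuclideanSpace ℝ (Fin m)))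
    (v : ℕ → EuclideanSpace ℝ (Fin m) → ℝ) (u : EuclideanSpace ℝ (Fin m) → ℝ) : Prop where
  bv_seq : ∀ i, IsBV Ω (v i)
  bv_lim : IsBV Ω u
  tendsto_L1 : Tendsto (fun i => ∫⁻ x in Ω, ‖v i x - u x‖ₑ) atTop (𝓝 0)
  tendsto_gradient : ∀ ψ : EuclideanSpace ℝ (Fin m) → EuclideanSpace ℝ (Fin m),
    Continuous ψ → (∀ x, x ∉ Ω → ψ x = 0) →
      Tendsto ψ (cocompact (EuclideanSpace ℝ (Fin m))) (𝓝 0) →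
      Tendsto (fun i => pairing (distribGradient Ω (v i)) ψ) atTop
        (𝓝 (pairing (distribGradient Ω u) ψ))

/-- The `C¹` model: `∫_Ω φ(|∇u(x)|) dx`, with values in `[0, ∞]`. -/
def TVcSmooth {m : ℕ} (φ : ℝ → ℝ) (Ω : Set (EuclideanSpace ℝ (Fin m)))
    (u : EuclideanSpace ℝ (Fin m) → ℝ) : ℝ≥0∞ :=
  ∫⁻ x in Ω, ENNReal.ofReal (φ ‖gradient u x‖)

/-- The relaxed continuous model: the infimum of `liminf_i ∫_Ω φ(|∇(v i)|) dx` over all sequences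
in `C¹(Ω)` (and in `BV(Ω)`) that converge to `u` weakly* in `BV(Ω)`. -/
def TVc {m : ℕ} (φ : ℝ → ℝ) (Ω : Set (EuclideanSpace ℝ (Fin m)))
    (u : EuclideanSpace ℝ (Fin m) → ℝ) : ℝ≥0∞ :=
  ⨅ (v : ℕ → EuclideanSpace ℝ (Fin m) → ℝ) (_ : ∀ i, ContDiffOn ℝ 1 (v i) Ω)
    (_ : WeakStarBV Ω v u), liminf (fun i => TVcSmooth φ Ω (v i)) atTop

end

/-!
The equality of the relaxed energy with `φinf * TV` is proved by two inequalities, neither of which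
needs any regularity of the boundary of `Ω`.

*Lower bound.* Since `φ` is concave with `φ 0 = 0`, the quotient `φ t / t` decreases to `φinf`, so
`φinf * t ≤ φ t`. For a `C¹` function `v` and a test field `ψ` with `|ψ| ≤ 1`, integration by parts
turns the pairing of `Dv` with `ψ` into `∫ ψ · ∇v ≤ ∫ |∇v|`. Weak* convergence passes this to the
limit, and `|Du|(Ω)` is the supremum of the pairings of `Du` with such fields
(`variation_le_of_forall_isTestField`). This is `mul_TV_le_liminf`.

*Upper bound.* The Meyers–Serrin construction (`IsDistribGradient.exists_contDiffOn_approx`) gives a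
smooth `v` which is close to `u` in `L¹(Ω)` and satisfies `∫ |∇v| ≤ |Du|(Ω) + δ`; soft thresholding
makes it vanish off a set `A` of finite measure (`exists_approx_finite_measure`). To make the energy
only see the slope of `φ` at infinity, the gradient has to be concentrated where it is large: `v` is
replaced by `w = δ h(v / δ)`, where `h` is a smoothed staircase with `|h(s) - s| ≤ 1`. Its
derivative is the shift by some `a` of a 1-periodic density `P` of mean one, whose support occupies
a small proportion `η` of the period. On `A`, where `h' ≠ 0`, the bound `φ t ≤ (φinf + ε₁) t + C`
applies; elsewhere `∇w = 0` and `φ 0 = 0`. Averaged over the shifts `a`, the energy is at most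
`(φinf + ε₁) ∫ |∇v| + η C |A|`, so that some shift achieves this bound
(`exists_TVcSmooth_staircase_le`). The averaging replaces any information on the level sets of `v`,
such as the coarea formula or Sard's theorem.

Finally, the functions obtained have bounded total variation, and for such sequences convergence in
`L¹` implies weak* convergence, because test fields are dense in `C₀` with respect to the uniform
norm (`tendsto_pairing_of_variation_le`).
-/

/-! ### Test fields and cutoff functions -/

/-- `ψ ∈ C_c^∞(Ω; ℝ^m)`, extended by zero to `ℝ^m`. -/
structure IsTestField {m : ℕ} (Ω : Set (EuclideanSpace ℝ (Fin m)))
    (ψ : EuclideanSpace ℝ (Fin m) → EuclideanSpace ℝ (Fin m)) : Prop where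
  contDiff : ContDiff ℝ (⊤ : ℕ∞) ψ
  hasCompactSupport : HasCompactSupport ψ
  tsupport_subset : tsupport ψ ⊆ Ω

/-- `χ ∈ C_c^∞(Ω; [0, 1])`, extended by zero. -/
structure IsCutoff {E : Type*} [NormedAddCommGroup E] [NormedSpace ℝ E] (Ω : Set E)
    (χ : E → ℝ) : Prop where
  contDiff : ContDiff ℝ (⊤ : ℕ∞) χ
  hasCompactSupport : HasCompactSupport χ
  tsupport_subset : tsupport χ ⊆ Ω
  nonneg : ∀ x, 0 ≤ χ x
  le_one : ∀ x, χ x ≤ 1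

theorem exists_isCutoff_eventuallyEq_one {E : Type*} [NormedAddCommGroup E] [NormedSpace ℝ E]
    [FiniteDimensional ℝ E] {K Ω : Set E} (hK : IsCompact K) (hΩ : IsOpen Ω) (hKΩ : K ⊆ Ω) :
    ∃ χ : E → ℝ, IsCutoff Ω χ ∧ ∀ᶠ x in 𝓝ˢ K, χ x = 1 := by
  obtain ⟨L, hL, hKL, hLΩ⟩ := exists_compact_between hK hΩ hKΩ
  obtain ⟨f, hf0, hf1, hf⟩ := exists_contMDiffMap_zero_one_nhds_of_isClosed (modelWithCornersSelf ℝ E)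
    (n := ⊤) (s := (interior L)ᶜ) (t := K) isOpen_interior.isClosed_compl hK.isClosed
    (disjoint_compl_left_iff_subset.2 hKL)
  have hsupp : tsupport f ⊆ interior L := by
    intro x hx
    by_contra hxL
    have h := (eventually_nhdsSet_iff_forall.1 hf0) x hxL
    exact (notMem_tsupport_iff_eventuallyEq.2 h) hx
  refine ⟨f, ⟨f.contMDiff.contDiff, ?_, hsupp.trans (interior_subset.trans hLΩ),
    fun x => (hf x).1, fun x => (hf x).2⟩, hf1⟩
  exact hL.of_isClosed_subset (isClosed_tsupport _) (hsupp.trans interior_subset)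

section TestFields

variable {m : ℕ} {Ω : Set (EuclideanSpace ℝ (Fin m))}
  {ψ : EuclideanSpace ℝ (Fin m) → EuclideanSpace ℝ (Fin m)}

theorem IsTestField.eq_zero (h : IsTestField Ω ψ) {x : EuclideanSpace ℝ (Fin m)} (hx : x ∉ Ω) :
    ψ x = 0 :=
  image_eq_zero_of_notMem_tsupport fun hx' => hx (h.tsupport_subset hx')

theorem isTestField_zero : IsTestField Ω 0 :=
  ⟨contDiff_const, HasCompactSupport.zero, by simp [tsupport]⟩

theorem IsTestField.add {ψ' : EuclideanSpace ℝ (Fin m) → EuclideanSpace ℝ (Fin m)}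
    (h : IsTestField Ω ψ) (h' : IsTestField Ω ψ') : IsTestField Ω (fun x => ψ x + ψ' x) :=
  ⟨h.contDiff.add h'.contDiff, h.hasCompactSupport.add h'.hasCompactSupport,
    (tsupport_add ψ ψ').trans (union_subset h.tsupport_subset h'.tsupport_subset)⟩

theorem IsTestField.sum {ι : Type*} (s : Finset ι)
    {ψ : ι → EuclideanSpace ℝ (Fin m) → EuclideanSpace ℝ (Fin m)}
    (h : ∀ i ∈ s, IsTestField Ω (ψ i)) : IsTestField Ω (fun x => ∑ i ∈ s, ψ i x) := by
  classical
  induction s using Finset.induction_on with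
  | empty => simpa using! isTestField_zero
  | insert i s hi ih =>
    simp only [Finset.sum_insert hi]
    exact (h i (by simp)).add (ih fun j hj => h j (by simp [hj]))

theorem IsCutoff.isTestField_smul {χ : EuclideanSpace ℝ (Fin m) → ℝ} (hχ : IsCutoff Ω χ)
    (hψ : ContDiff ℝ (⊤ : ℕ∞) ψ) : IsTestField Ω (fun x => χ x • ψ x) :=
  ⟨hχ.contDiff.smul hψ, hχ.hasCompactSupport.smul_right,
    (tsupport_smul_subset_left χ ψ).trans hχ.tsupport_subset⟩

/-- A continuous field which lives in `Ω` and has compact support there can be approximated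
uniformly by test fields. -/
theorem exists_isTestField_norm_sub_le (hψ : Continuous ψ) (hc : HasCompactSupport ψ)
    (hs : tsupport ψ ⊆ Ω) {ε : ℝ} (hε : 0 < ε) :
    ∃ ψ', IsTestField Ω ψ' ∧ ∀ x, ‖ψ x - ψ' x‖ ≤ ε := by
  obtain ⟨g, hg, hd, hsupp⟩ := hψ.exists_contDiff_approx ⊤ (continuous_const (y := ε)) fun _ => hε
  have ht : tsupport g ⊆ tsupport ψ := closure_mono hsupp
  refine ⟨g, ⟨hg, hc.of_isClosed_subset (isClosed_tsupport _) ht, ht.trans hs⟩, fun x => ?_⟩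
  have := (hd x).le
  rwa [dist_eq_norm, norm_sub_rev] at this

/-- `C_c^∞(Ω; ℝ^m)` is dense in `C₀(Ω; ℝ^m)`. -/
theorem exists_isTestField_norm_sub_le_of_tendsto (hΩ : IsOpen Ω) (hψ : Continuous ψ)
    (h0 : ∀ x, x ∉ Ω → ψ x = 0) (hlim : Tendsto ψ (cocompact (EuclideanSpace ℝ (Fin m))) (𝓝 0))
    {ε : ℝ} (hε : 0 < ε) : ∃ ψ', IsTestField Ω ψ' ∧ ∀ x, ‖ψ x - ψ' x‖ ≤ ε := by
  have hK : IsCompact {x | ε / 2 ≤ ‖ψ x‖} := by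
    have h := hlim.norm
    rw [norm_zero] at h
    have h2 := h.eventually (gt_mem_nhds (half_pos hε))
    rw [Filter.Eventually, mem_cocompact] at h2
    obtain ⟨t, ht, hts⟩ := h2
    refine ht.of_isClosed_subset (isClosed_le continuous_const hψ.norm) fun x hx => ?_
    by_contra hxt
    have h3 : ‖ψ x‖ < ε / 2 := hts hxt
    exact absurd h3 (not_lt.2 hx)
  have hKΩ : {x | ε / 2 ≤ ‖ψ x‖} ⊆ Ω := by
    intro x hx
    by_contra hxΩ
    have : ε / 2 ≤ ‖ψ x‖ := hx
    rw [h0 x hxΩ, norm_zero] at this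
    linarith
  obtain ⟨χ, hχ, hχ1⟩ := exists_isCutoff_eventuallyEq_one hK hΩ hKΩ
  obtain ⟨ψ', hψ', hd⟩ := exists_isTestField_norm_sub_le (Ω := Ω) (ψ := fun x => χ x • ψ x)
    (hχ.contDiff.continuous.smul hψ) hχ.hasCompactSupport.smul_right
    ((tsupport_smul_subset_left χ ψ).trans hχ.tsupport_subset) (half_pos hε)
  refine ⟨ψ', hψ', fun x => ?_⟩
  have h1 : ‖ψ x - χ x • ψ x‖ ≤ ε / 2 := by
    by_cases hx : ε / 2 ≤ ‖ψ x‖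
    · rw [hχ1.self_of_nhdsSet x hx]; simp only [one_smul, sub_self, norm_zero]; positivity
    · have e : ψ x - χ x • ψ x = (1 - χ x) • ψ x := by rw [sub_smul, one_smul]
      rw [e, norm_smul, Real.norm_of_nonneg (by linarith [hχ.le_one x])]
      have := hχ.nonneg x
      nlinarith [norm_nonneg (ψ x)]
  calc ‖ψ x - ψ' x‖ = ‖(ψ x - χ x • ψ x) + (χ x • ψ x - ψ' x)‖ := by congr 1; abel
    _ ≤ ε / 2 + ε / 2 := (norm_add_le _ _).trans (add_le_add h1 (hd x))
    _ = ε := by ring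

end TestFields

/-! ### Integrals of fields against vector measures -/

section Pairing

variable {m : ℕ} {Ω : Set (EuclideanSpace ℝ (Fin m))}
  {μ : VectorMeasure (EuclideanSpace ℝ (Fin m)) (EuclideanSpace ℝ (Fin m))}
  {ψ ψ' : EuclideanSpace ℝ (Fin m) → EuclideanSpace ℝ (Fin m)}

theorem norm_pairing_le_integral_norm : ‖pairing μ ψ‖ ≤ ∫ x, ‖ψ x‖ ∂μ.variation := by
  refine (VectorMeasure.norm_integral_le_integral_norm).trans ?_
  have h : ‖(innerSL ℝ : EuclideanSpace ℝ (Fin m) →L[ℝ] _)‖ ≤ 1 := norm_innerSL_le _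
  exact mul_le_of_le_one_left (integral_nonneg fun _ => norm_nonneg _) h

theorem pairing_sub (h : Integrable ψ μ.variation) (h' : Integrable ψ' μ.variation) :
    pairing μ (fun x => ψ x - ψ' x) = pairing μ ψ - pairing μ ψ' :=
  VectorMeasure.integral_fun_sub h h'

theorem abs_pairing_sub_le (h : Integrable ψ μ.variation) (h' : Integrable ψ' μ.variation) :
    |pairing μ ψ - pairing μ ψ'| ≤ ∫ x, ‖ψ x - ψ' x‖ ∂μ.variation := by
  rw [← pairing_sub h h', ← Real.norm_eq_abs]
  exact norm_pairing_le_integral_norm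

theorem integral_norm_le_mul_variation [IsFiniteMeasure μ.variation] {C : ℝ}
    (h : ∀ x, ‖ψ x‖ ≤ C) : ∫ x, ‖ψ x‖ ∂μ.variation ≤ C * μ.variation.real univ := by
  have := norm_integral_le_of_norm_le_const (μ := μ.variation) (f := fun x => ‖ψ x‖) (C := C)
    (Eventually.of_forall fun x => by simpa using h x)
  exact (le_abs_self _).trans this

theorem IsTestField.integrable {ν : Measure (EuclideanSpace ℝ (Fin m))} [IsFiniteMeasure ν]
    (h : IsTestField Ω ψ) : Integrable ψ ν :=
  h.contDiff.continuous.integrable_of_hasCompactSupport h.hasCompactSupport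

/-- Truncation of a vector to the closed unit ball. -/
noncomputable def unitBallTruncation {V : Type*} [NormedAddCommGroup V] [NormedSpace ℝ V] (y : V) :
    V := (max 1 ‖y‖)⁻¹ • y

section Truncation
variable {V : Type*} [NormedAddCommGroup V] [NormedSpace ℝ V]

theorem continuous_unitBallTruncation : Continuous (unitBallTruncation : V → V) := by
  unfold unitBallTruncation
  refine Continuous.smul (Continuous.inv₀ (by fun_prop) fun y => ?_) continuous_id
  exact (lt_of_lt_of_le one_pos (le_max_left _ _)).ne'

theorem norm_unitBallTruncation_le (y : V) : ‖unitBallTruncation y‖ ≤ 1 := by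
  have h : 0 < max 1 ‖y‖ := lt_of_lt_of_le one_pos (le_max_left _ _)
  rw [unitBallTruncation, norm_smul, norm_inv, Real.norm_of_nonneg h.le, inv_mul_le_iff₀ h, mul_one]
  exact le_max_right _ _

theorem norm_sub_unitBallTruncation_le {z : V} (hz : ‖z‖ ≤ 1) (y : V) :
    ‖z - unitBallTruncation y‖ ≤ 2 * ‖z - y‖ := by
  have h : 0 < max 1 ‖y‖ := lt_of_lt_of_le one_pos (le_max_left _ _)
  have h1 : ‖y - unitBallTruncation y‖ ≤ ‖z - y‖ := by
    have e : y - unitBallTruncation y = (1 - (max 1 ‖y‖)⁻¹) • y := by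
      rw [unitBallTruncation, sub_smul, one_smul]
    have h2 : (max 1 ‖y‖)⁻¹ ≤ 1 := inv_le_one_of_one_le₀ (le_max_left _ _)
    rw [e, norm_smul, Real.norm_of_nonneg (by linarith)]
    have h3 : ‖y‖ - ‖z‖ ≤ ‖z - y‖ := by rw [norm_sub_rev]; exact norm_sub_norm_le _ _
    rcases le_total ‖y‖ 1 with hy | hy
    · rw [max_eq_left hy]; simp
    · rw [max_eq_right hy, sub_mul, inv_mul_cancel₀ (by linarith : ‖y‖ ≠ 0)]
      linarith
  calc ‖z - unitBallTruncation y‖ = ‖(z - y) + (y - unitBallTruncation y)‖ := by congr 1; abel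
    _ ≤ ‖z - y‖ + ‖z - y‖ := (norm_add_le _ _).trans (add_le_add le_rfl h1)
    _ = _ := by ring

end Truncation

/-- Up to an arbitrarily small error, the variation of a vector measure is attained by a simple
field with values in the unit ball. -/
theorem exists_simple_lt_pairing [IsFiniteMeasure μ.variation] (hΩ : MeasurableSet Ω) {a : ℝ}
    (ha : ENNReal.ofReal a < μ.variation Ω) :
    ∃ ψ, Measurable ψ ∧ (∀ x, ‖ψ x‖ ≤ 1) ∧ (∀ x, x ∉ Ω → ψ x = 0) ∧ a < pairing μ ψ := by
  classical
  obtain ⟨P, hPs, hPd, hPm, hP⟩ := μ.exists_lt_sum_of_lt_variation hΩ ha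
  let ψ : EuclideanSpace ℝ (Fin m) → EuclideanSpace ℝ (Fin m) :=
    fun x => ∑ p ∈ P, p.indicator (fun _ => ‖μ p‖⁻¹ • μ p) x
  have hle : ∀ y : EuclideanSpace ℝ (Fin m), ‖‖y‖⁻¹ • y‖ ≤ 1 := fun y => by
    rw [norm_smul, norm_inv, norm_norm]; exact inv_mul_le_one
  refine ⟨ψ, ?_, fun x => ?_, fun x hx => ?_, ?_⟩
  · exact Finset.measurable_fun_sum _ fun p hp => measurable_const.indicator (hPm p hp)
  · by_cases h : ∃ p ∈ P, x ∈ p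
    · obtain ⟨p, hp, hxp⟩ := h
      have : ψ x = ‖μ p‖⁻¹ • μ p := by
        rw [← indicator_of_mem hxp (fun _ => ‖μ p‖⁻¹ • μ p)]
        refine Finset.sum_eq_single_of_mem p hp fun q hq hqp => indicator_of_notMem (fun hxq => ?_) _
        exact (disjoint_left.1 (hPd hq hp hqp)) hxq hxp
      rw [this]; exact hle _
    · push Not at h
      have : ψ x = 0 := Finset.sum_eq_zero fun p hp => indicator_of_notMem (h p hp) _
      simp [this]
  · exact Finset.sum_eq_zero fun p hp => indicator_of_notMem (fun h => hx (hPs p hp h)) _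
  · have e : pairing μ ψ = ∑ p ∈ P, ‖μ p‖ := by
      unfold pairing
      rw [VectorMeasure.integral_finsetSum]
      · refine Finset.sum_congr rfl fun p hp => ?_
        rw [VectorMeasure.integral_indicator_const _ (hPm p hp)]
        rw [innerSL_apply_apply, real_inner_smul_left, real_inner_self_eq_norm_sq]
        rcases eq_or_ne ‖μ p‖ 0 with h | h
        · simp [h]
        · field_simp
      · exact fun p hp => (integrable_const _).indicator (hPm p hp)
    rw [e]
    have e2 : ∑ p ∈ P, ‖μ p‖ₑ = ENNReal.ofReal (∑ p ∈ P, ‖μ p‖) := by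
      rw [ENNReal.ofReal_sum_of_nonneg fun _ _ => norm_nonneg _]
      simp
    rw [e2] at hP
    exact (ENNReal.ofReal_lt_ofReal_iff'.1 hP).1

/-- The variation on an open set is the supremum of the pairings with test fields
which are bounded by one. -/
theorem exists_isTestField_lt_pairing [IsFiniteMeasure μ.variation] (hΩ : IsOpen Ω)
    (hμ : μ.restrict Ω = μ) {a : ℝ} (ha : ENNReal.ofReal a < μ.variation Ω) :
    ∃ ψ, IsTestField Ω ψ ∧ (∀ x, ‖ψ x‖ ≤ 1) ∧ a < pairing μ ψ := by
  obtain ⟨ψ₀, hm₀, hψ₀, hz₀, hp₀⟩ := exists_simple_lt_pairing hΩ.measurableSet ha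
  set ν := μ.variation
  have hi₀ : Integrable ψ₀ ν := Integrable.of_bound hm₀.aestronglyMeasurable 1 (ae_of_all _ hψ₀)
  set c := ν.real univ
  have hc : 0 ≤ c := measureReal_nonneg
  obtain ⟨δ, hδ, hδ1, hδd⟩ : ∃ δ : ℝ, 0 < δ ∧ δ ≤ 1 ∧ (4 + 2 * c) * δ < pairing μ ψ₀ - a := by
    have hd : 0 < pairing μ ψ₀ - a := by linarith
    refine ⟨min 1 ((pairing μ ψ₀ - a) / (5 + 2 * c)), by positivity, min_le_left _ _, ?_⟩
    calc (4 + 2 * c) * min 1 ((pairing μ ψ₀ - a) / (5 + 2 * c))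
        ≤ (4 + 2 * c) * ((pairing μ ψ₀ - a) / (5 + 2 * c)) := by gcongr; exact min_le_right _ _
      _ < (5 + 2 * c) * ((pairing μ ψ₀ - a) / (5 + 2 * c)) := by gcongr; norm_num
      _ = _ := by field_simp
  obtain ⟨g, -, hgd, hg, hgi⟩ := hi₀.exists_hasCompactSupport_integral_sub_le hδ
  obtain ⟨K, hKΩ, hK, hKν⟩ := hΩ.measurableSet.exists_isCompact_sdiff_lt (measure_ne_top ν Ω)
    (ε := ENNReal.ofReal δ) (by simpa using hδ)
  have hKc : ν.real Kᶜ ≤ δ := by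
    have hν : ν = ν.restrict Ω := by
      rw [← VectorMeasure.variation_restrict hΩ.measurableSet, hμ]
    refine ENNReal.toReal_le_of_le_ofReal hδ.le ?_
    rw [hν, Measure.restrict_apply hK.measurableSet.compl, inter_comm, ← sdiff_eq]
    exact hKν.le
  obtain ⟨χ, hχ, hχ1⟩ := exists_isCutoff_eventuallyEq_one hK hΩ hKΩ
  set ψ₁ := fun x => χ x • unitBallTruncation (g x)
  have hψ₁c : Continuous ψ₁ := hχ.contDiff.continuous.smul (continuous_unitBallTruncation.comp hg)
  have hψ₁s : HasCompactSupport ψ₁ := hχ.hasCompactSupport.smul_right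
  have hψ₁t : tsupport ψ₁ ⊆ Ω := (tsupport_smul_subset_left χ _).trans hχ.tsupport_subset
  have hψ₁1 : ∀ x, ‖ψ₁ x‖ ≤ 1 := fun x => by
    simp only [ψ₁, norm_smul, Real.norm_of_nonneg (hχ.nonneg x)]
    exact mul_le_one₀ (hχ.le_one x) (norm_nonneg _) (norm_unitBallTruncation_le _)
  have hi₁ : Integrable ψ₁ ν := hψ₁c.integrable_of_hasCompactSupport hψ₁s
  -- the error of the first approximation is small in `L¹(|μ|)`
  have hE1 : ∫ x, ‖ψ₀ x - ψ₁ x‖ ∂ν ≤ 4 * δ := by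
    have hpt : ∀ x, ‖ψ₀ x - ψ₁ x‖ ≤ 2 * ‖ψ₀ x - g x‖ + Kᶜ.indicator (fun _ => (2 : ℝ)) x := by
      intro x
      by_cases hx : x ∈ K
      · have : ψ₁ x = unitBallTruncation (g x) := by
          simp only [ψ₁, hχ1.self_of_nhdsSet x hx, one_smul]
        rw [this, indicator_of_notMem (by simpa using hx), add_zero]
        exact norm_sub_unitBallTruncation_le (hψ₀ x) _
      · rw [indicator_of_mem (by simpa using hx)]
        have := norm_sub_le (ψ₀ x) (ψ₁ x)
        linarith [hψ₀ x, hψ₁1 x, norm_nonneg (ψ₀ x - g x)]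
    have hI : Integrable (fun x => 2 * ‖ψ₀ x - g x‖) ν := (hi₀.sub hgi).norm.const_mul 2
    have hI' : Integrable (Kᶜ.indicator (fun _ => (2 : ℝ))) ν :=
      (integrable_const _).indicator hK.measurableSet.compl
    calc ∫ x, ‖ψ₀ x - ψ₁ x‖ ∂ν
        ≤ ∫ x, (2 * ‖ψ₀ x - g x‖ + Kᶜ.indicator (fun _ => (2 : ℝ)) x) ∂ν :=
          integral_mono (hi₀.sub hi₁).norm (hI.add hI') hpt
      _ = 2 * ∫ x, ‖ψ₀ x - g x‖ ∂ν + ν.real Kᶜ * 2 := by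
          rw [integral_add hI hI', integral_const_mul, integral_indicator hK.measurableSet.compl]
          simp
      _ ≤ 4 * δ := by linarith
  -- shrinking by `1 - δ` leaves room for a smoothing error `δ` inside the unit ball
  obtain ⟨ψ, hψ, hψd⟩ := exists_isTestField_norm_sub_le (Ω := Ω) (ψ := fun x => (1 - δ) • ψ₁ x)
    (by fun_prop) (hψ₁s.smul_left (f := fun _ => 1 - δ))
    ((tsupport_smul_subset_right (fun _ => 1 - δ) ψ₁).trans hψ₁t) hδ
  have hb : ∀ x, ‖(1 - δ) • ψ₁ x‖ ≤ 1 - δ := fun x => by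
    rw [norm_smul, Real.norm_of_nonneg (by linarith)]
    exact mul_le_of_le_one_right (by linarith) (hψ₁1 x)
  have hE2 : ∀ x, ‖ψ₁ x - ψ x‖ ≤ 2 * δ := fun x => by
    have e : ψ₁ x - ψ x = δ • ψ₁ x + ((1 - δ) • ψ₁ x - ψ x) := by
      rw [sub_smul, one_smul]; abel
    rw [e]
    refine (norm_add_le _ _).trans ?_
    rw [norm_smul, Real.norm_of_nonneg hδ.le]
    nlinarith [hψ₁1 x, hψd x]
  refine ⟨ψ, hψ, fun x => ?_, ?_⟩
  · have e : ψ x = (1 - δ) • ψ₁ x - ((1 - δ) • ψ₁ x - ψ x) := by abel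
    rw [e]
    refine (norm_sub_le _ _).trans ?_
    linarith [hb x, hψd x]
  · have h1 := abs_pairing_sub_le hi₀ hi₁
    have h2 := (abs_pairing_sub_le hi₁ hψ.integrable).trans
      (integral_norm_le_mul_variation (μ := μ) (ψ := fun x => ψ₁ x - ψ x) hE2)
    have h1' := (abs_le.1 (h1.trans hE1)).2
    have h2' := (abs_le.1 h2).2
    have h3 : (4 + 2 * c) * δ = 4 * δ + 2 * δ * c := by ring
    change pairing μ ψ₁ - pairing μ ψ ≤ 2 * δ * c at h2'
    linarith

theorem variation_le_of_forall_isTestField [IsFiniteMeasure μ.variation] (hΩ : IsOpen Ω)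
    (hμ : μ.restrict Ω = μ) {C : ℝ≥0∞}
    (h : ∀ ψ, IsTestField Ω ψ → (∀ x, ‖ψ x‖ ≤ 1) → ENNReal.ofReal (pairing μ ψ) ≤ C) :
    μ.variation Ω ≤ C := by
  by_contra! hlt
  obtain ⟨ψ, hψ, hψ1, hp⟩ := exists_isTestField_lt_pairing (a := C.toReal) hΩ hμ
    (by rwa [ENNReal.ofReal_toReal hlt.ne_top])
  have h2 := h ψ hψ hψ1
  rw [ENNReal.ofReal_le_iff_le_toReal hlt.ne_top] at h2
  linarith

/-- Integration of bounded fields against the vector measure with a density `g`. -/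
theorem pairing_withDensity {ν : Measure (EuclideanSpace ℝ (Fin m))}
    {g : EuclideanSpace ℝ (Fin m) → EuclideanSpace ℝ (Fin m)} (hg : Integrable g ν)
    (hψ : Measurable ψ) {C : ℝ} (hC : ∀ x, ‖ψ x‖ ≤ C) :
    pairing (ν.withDensityᵥ g) ψ = ∫ x, inner ℝ (ψ x) (g x) ∂ν := by
  have hvar := Measure.variation_withDensityᵥ hg
  have hfin : IsFiniteMeasure (ν.withDensityᵥ g).variation := by
    rw [hvar]; exact ⟨by simpa using! hg.2⟩
  have hint : ∀ f : EuclideanSpace ℝ (Fin m) → EuclideanSpace ℝ (Fin m), Measurable f →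
      ∀ D, (∀ x, ‖f x‖ ≤ D) → Integrable (fun x => inner ℝ (f x) (g x)) ν := by
    intro f hf D hD
    refine (hg.norm.const_mul D).mono' (hf.aestronglyMeasurable.inner hg.1) (ae_of_all _ fun x => ?_)
    exact (norm_inner_le_norm _ _).trans (by gcongr; exact hD x)
  have hsimple : ∀ f : SimpleFunc (EuclideanSpace ℝ (Fin m)) (EuclideanSpace ℝ (Fin m)),
      pairing (ν.withDensityᵥ g) f = ∫ x, inner ℝ (f x) (g x) ∂ν := by
    intro f
    have hbd : ∀ f : SimpleFunc (EuclideanSpace ℝ (Fin m)) (EuclideanSpace ℝ (Fin m)),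
        ∃ D, ∀ x, ‖f x‖ ≤ D := fun f => f.exists_forall_norm_le
    induction f using SimpleFunc.induction with
    | const c hs =>
      rename_i s
      have e : ⇑(SimpleFunc.piecewise s hs (SimpleFunc.const _ c) (SimpleFunc.const _ 0))
          = s.indicator (fun _ => c) := by
        ext1 x; by_cases hx : x ∈ s <;> simp [hx]
      rw [e]
      unfold pairing
      rw [VectorMeasure.integral_indicator_const _ hs, withDensityᵥ_apply hg hs,
        ← integral_indicator hs, innerSL_apply_apply, ← integral_inner (hg.indicator hs)]
      congr 1; ext x
      by_cases hx : x ∈ s <;> simp [hx]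
    | add _ h₁ h₂ =>
      rename_i f₁ f₂ _
      obtain ⟨D₁, hD₁⟩ := hbd f₁
      obtain ⟨D₂, hD₂⟩ := hbd f₂
      have e : pairing (ν.withDensityᵥ g) (⇑(f₁ + f₂)) =
          pairing (ν.withDensityᵥ g) f₁ + pairing (ν.withDensityᵥ g) f₂ :=
        VectorMeasure.integral_fun_add (Integrable.of_bound f₁.aestronglyMeasurable D₁ (ae_of_all _ hD₁))
          (Integrable.of_bound f₂.aestronglyMeasurable D₂ (ae_of_all _ hD₂))
      rw [e, h₁, h₂, ← integral_add (hint _ f₁.measurable D₁ hD₁) (hint _ f₂.measurable D₂ hD₂)]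
      simp [inner_add_left]
  -- approximate by simple functions which are dominated by `2 C`
  let F : ℕ → SimpleFunc (EuclideanSpace ℝ (Fin m)) (EuclideanSpace ℝ (Fin m)) :=
    fun n => SimpleFunc.approxOn ψ hψ univ 0 (mem_univ _) n
  have hF : ∀ n x, ‖F n x‖ ≤ 2 * C := fun n x => by
    have := SimpleFunc.norm_approxOn_zero_le hψ (mem_univ 0) x n
    have h2 := hC x
    exact this.trans (by linarith)
  have hFt : ∀ x, Tendsto (fun n => F n x) atTop (𝓝 (ψ x)) := fun x =>
    SimpleFunc.tendsto_approxOn hψ (mem_univ _) (by simp)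
  have h1 : Tendsto (fun n => pairing (ν.withDensityᵥ g) (F n)) atTop
      (𝓝 (pairing (ν.withDensityᵥ g) ψ)) :=
    tendsto_setToFun_of_dominated_convergence _ (fun _ => 2 * C)
      (fun n => (F n).aestronglyMeasurable) (integrable_const _)
      (fun n => ae_of_all _ (hF n)) (ae_of_all _ hFt)
  have h2 : Tendsto (fun n => ∫ x, inner ℝ (F n x) (g x) ∂ν) atTop
      (𝓝 (∫ x, inner ℝ (ψ x) (g x) ∂ν)) :=
    tendsto_integral_of_dominated_convergence (fun x => 2 * C * ‖g x‖)
      (fun n => (F n).aestronglyMeasurable.inner hg.1) (hg.norm.const_mul _)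
      (fun n => ae_of_all _ fun x => (norm_inner_le_norm _ _).trans (by gcongr; exact hF n x))
      (ae_of_all _ fun x => (hFt x).inner tendsto_const_nhds)
  simp only [hsimple] at h1
  exact tendsto_nhds_unique h1 h2

end Pairing

/-! ### Mollification -/

section Mollify

variable {m : ℕ} {F G : Type*} [NormedAddCommGroup F] [NormedSpace ℝ F]
  [NormedAddCommGroup G] [NormedSpace ℝ G]

/-- The mollification of `f` by the normalized bump function of `b`. -/
noncomputable def mollify (b : ContDiffBump (0 : EuclideanSpace ℝ (Fin m)))
    (f : EuclideanSpace ℝ (Fin m) → F) : EuclideanSpace ℝ (Fin m) → F :=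
  convolution (b.normed volume) f (ContinuousLinearMap.lsmul ℝ ℝ) volume

variable (b : ContDiffBump (0 : EuclideanSpace ℝ (Fin m)))
  {f g : EuclideanSpace ℝ (Fin m) → F}

theorem mollify_apply (f : EuclideanSpace ℝ (Fin m) → F) (x : EuclideanSpace ℝ (Fin m)) :
    mollify b f x = ∫ t, b.normed volume t • f (x - t) := rfl

theorem mollify_apply_swap (f : EuclideanSpace ℝ (Fin m) → F) (x : EuclideanSpace ℝ (Fin m)) :
    mollify b f x = ∫ t, b.normed volume (x - t) • f t := by
  rw [mollify, convolution_eq_swap]; rfl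

theorem integrable_normed_smul (hf : LocallyIntegrable f volume) (x : EuclideanSpace ℝ (Fin m)) :
    Integrable (fun t => b.normed volume t • f (x - t)) volume :=
  (b.hasCompactSupport_normed.convolutionExists_left (ContinuousLinearMap.lsmul ℝ ℝ)
    b.continuous_normed hf x).integrable

theorem contDiff_mollify [CompleteSpace F] (hf : LocallyIntegrable f volume) :
    ContDiff ℝ (⊤ : ℕ∞) (mollify b f) :=
  b.hasCompactSupport_normed.contDiff_convolution_left _ b.contDiff_normed hf

theorem integrable_mollify (hf : Integrable f volume) : Integrable (mollify b f) volume :=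
  b.integrable_normed.integrable_convolution _ hf

theorem norm_mollify_le [CompleteSpace F] (hf : AEStronglyMeasurable f volume) {C : ℝ} (hC0 : 0 ≤ C)
    (hC : ∀ x, ‖f x‖ ≤ C) (x : EuclideanSpace ℝ (Fin m)) : ‖mollify b f x‖ ≤ C := by
  have := dist_convolution_le (μ := volume) (g := f) (f := b.normed volume) (x₀ := x) (R := b.rOut)
    (z₀ := 0) hC0 b.support_normed_eq.subset b.nonneg_normed b.integral_normed hf
    (fun y _ => by simpa using hC y)
  simpa using! this

theorem mollify_eq_zero {x : EuclideanSpace ℝ (Fin m)}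
    (h : ∀ y ∈ Metric.ball x b.rOut, f y = 0) : mollify b f x = 0 := by
  rw [mollify_apply]
  refine integral_eq_zero_of_ae (ae_of_all _ fun t => ?_)
  by_cases ht : t ∈ Metric.ball (0 : EuclideanSpace ℝ (Fin m)) b.rOut
  · have : f (x - t) = 0 := h _ (by simpa [mem_ball_iff_norm] using ht)
    simp [this]
  · rw [← b.support_normed_eq (μ := volume)] at ht
    simp [Function.notMem_support.1 ht]

theorem mollify_sub (hf : LocallyIntegrable f volume) (hg : LocallyIntegrable g volume)
    (x : EuclideanSpace ℝ (Fin m)) :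
    mollify b (fun y => f y - g y) x = mollify b f x - mollify b g x := by
  simp only [mollify_apply, smul_sub]
  exact integral_sub (integrable_normed_smul b hf x) (integrable_normed_smul b hg x)

/-- Mollification is a contraction of `L¹`. -/
theorem integral_norm_mollify_le (hf : Integrable f volume) :
    ∫ x, ‖mollify b f x‖ ≤ ∫ x, ‖f x‖ := by
  have h1 : ∫ x, mollify b (fun y => ‖f y‖) x = ∫ x, ‖f x‖ := by
    have := integral_convolution (μ := volume) (ν := volume) (ContinuousLinearMap.lsmul ℝ ℝ)
      (b.integrable_normed (μ := volume)) hf.norm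
    rw [b.integral_normed] at this
    simpa using! this
  rw [← h1]
  refine integral_mono (integrable_mollify b hf).norm (integrable_mollify b hf.norm) fun x => ?_
  simp only [mollify_apply]
  refine (norm_integral_le_integral_norm _).trans_eq (integral_congr_ae (ae_of_all _ fun t => ?_))
  simp [norm_smul, abs_of_nonneg (b.nonneg_normed t)]

/-- Mollification converges to the identity in `L¹` as the radius tends to zero. -/
theorem exists_forall_integral_norm_mollify_sub_le [CompleteSpace F] (hf : Integrable f volume)
    {ε : ℝ} (hε : 0 < ε) :
    ∃ r > 0, ∀ b : ContDiffBump (0 : EuclideanSpace ℝ (Fin m)), b.rOut < r →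
      ∫ x, ‖mollify b f x - f x‖ ≤ ε := by
  obtain ⟨g, hgs, hgd, hg, hgi⟩ := hf.exists_hasCompactSupport_integral_sub_le
    (show 0 < ε / 3 by positivity)
  set S := Metric.cthickening 1 (tsupport g)
  have hS : IsCompact S := hgs.isCompact.cthickening
  set V := volume.real S
  have hV : 0 ≤ V := measureReal_nonneg
  obtain ⟨r, hr, hrg⟩ := Metric.uniformContinuous_iff.1
    (hgs.uniformContinuous_of_continuous hg) (ε / (3 * (V + 1))) (by positivity)
  refine ⟨min r 1, by positivity, fun b hb => ?_⟩
  have hb1 : b.rOut < r := hb.trans_le (min_le_left _ _)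
  have hb2 : b.rOut < 1 := hb.trans_le (min_le_right _ _)
  have hpt : ∀ x, ‖mollify b g x - g x‖ ≤ S.indicator (fun _ => ε / (3 * (V + 1))) x := by
    intro x
    by_cases hx : x ∈ S
    · rw [indicator_of_mem hx, ← dist_eq_norm]
      exact b.dist_normed_convolution_le hg.aestronglyMeasurable fun y hy =>
        (hrg ((Metric.mem_ball.1 hy).trans hb1)).le
    · have hz : ∀ y ∈ Metric.ball x b.rOut, g y = 0 := fun y hy => by
        refine image_eq_zero_of_notMem_tsupport fun hy' => hx ?_
        refine Metric.mem_cthickening_of_dist_le x y 1 _ hy' ?_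
        rw [dist_comm]
        exact ((Metric.mem_ball.1 hy).trans hb2).le
      rw [indicator_of_notMem hx, mollify_eq_zero b hz, hz x (Metric.mem_ball_self b.rOut_pos)]
      simp
  have hI : Integrable (S.indicator fun _ => ε / (3 * (V + 1))) volume :=
    (integrableOn_const hS.measure_lt_top.ne).integrable_indicator hS.measurableSet
  have h2 : ∫ x, ‖mollify b g x - g x‖ ≤ ε / 3 := by
    refine (integral_mono ((integrable_mollify b hgi).sub hgi).norm hI hpt).trans ?_
    rw [integral_indicator hS.measurableSet, setIntegral_const, smul_eq_mul]
    change V * _ ≤ _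
    rw [mul_div_assoc', div_le_div_iff₀ (by positivity) (by positivity)]
    nlinarith
  have h3 : ∫ x, ‖mollify b (fun y => f y - g y) x‖ ≤ ε / 3 :=
    (integral_norm_mollify_le b (hf.sub hgi)).trans hgd
  have hfm : Integrable (mollify b fun y => f y - g y) volume := integrable_mollify b (hf.sub hgi)
  have hgm : Integrable (fun x => mollify b g x - g x) volume := (integrable_mollify b hgi).sub hgi
  calc ∫ x, ‖mollify b f x - f x‖
      ≤ ∫ x, (‖mollify b (fun y => f y - g y) x‖ + ‖mollify b g x - g x‖ + ‖f x - g x‖) := by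
        refine integral_mono ((integrable_mollify b hf).sub hf).norm
          ((hfm.norm.add hgm.norm).add (hf.sub hgi).norm)
          fun x => ?_
        have e : mollify b f x - f x = mollify b (fun y => f y - g y) x + (mollify b g x - g x)
            - (f x - g x) := by
          rw [mollify_sub b hf.locallyIntegrable hgi.locallyIntegrable]; abel
        rw [e]
        exact (norm_sub_le _ _).trans (add_le_add (norm_add_le _ _) le_rfl)
    _ = _ := integral_add (hfm.norm.add hgm.norm)
          (hf.sub hgi).norm
    _ = _ := by rw [integral_add hfm.norm hgm.norm]
    _ ≤ ε / 3 + ε / 3 + ε / 3 := add_le_add (add_le_add h3 h2) hgd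
    _ = ε := by ring

/-- Mollification is symmetric, since the bump function is even. -/
theorem integral_mollify_comm [CompleteSpace F] [CompleteSpace G] (B : F →L[ℝ] G →L[ℝ] ℝ)
    (hf : Integrable f volume)
    {h : EuclideanSpace ℝ (Fin m) → G} (hh : Continuous h) (hs : HasCompactSupport h) :
    ∫ x, B (mollify b f x) (h x) = ∫ x, B (f x) (mollify b h x) := by
  obtain ⟨C, hC⟩ := hs.exists_bound_of_continuous hh
  have hint : Integrable (fun p : EuclideanSpace ℝ (Fin m) × EuclideanSpace ℝ (Fin m) =>
      b.normed volume (p.1 - p.2) • B (f p.2) (h p.1)) (volume.prod volume) := by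
    have h0 := (hf.convolution_integrand (ContinuousLinearMap.lsmul ℝ ℝ).flip
      (b.integrable_normed (μ := volume)) (ν := volume))
    refine (h0.norm.const_mul (‖B‖ * C)).mono' ?_ (ae_of_all _ fun p => ?_)
    · have hm1 : AEStronglyMeasurable (fun p : EuclideanSpace ℝ (Fin m) × EuclideanSpace ℝ (Fin m) =>
          b.normed volume (p.1 - p.2)) (volume.prod volume) :=
        ((b.continuous_normed (μ := volume)).comp
          (continuous_fst.sub continuous_snd)).aestronglyMeasurable
      have hm2 : AEStronglyMeasurable (fun p : EuclideanSpace ℝ (Fin m) × EuclideanSpace ℝ (Fin m) =>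
          B (f p.2) (h p.1)) (volume.prod volume) :=
        B.aestronglyMeasurable_comp₂ hf.1.comp_snd (hh.comp continuous_fst).aestronglyMeasurable
      exact hm1.smul hm2
    · simp only [ContinuousLinearMap.flip_apply, ContinuousLinearMap.lsmul_apply, norm_smul]
      have h1 : ‖B (f p.2) (h p.1)‖ ≤ ‖B‖ * ‖f p.2‖ * C :=
        (B.le_opNorm₂ _ _).trans (by gcongr; exact hC _)
      calc _ ≤ ‖b.normed volume (p.1 - p.2)‖ * (‖B‖ * ‖f p.2‖ * C) := by gcongr
        _ = _ := by ring
  have hhi : LocallyIntegrable h volume := hh.locallyIntegrable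
  calc ∫ x, B (mollify b f x) (h x)
      = ∫ x, ∫ y, b.normed volume (x - y) • B (f y) (h x) := by
        refine integral_congr_ae ?_
        filter_upwards [((b.hasCompactSupport_normed (μ := volume)).convolutionExists_left
          (ContinuousLinearMap.lsmul ℝ ℝ) (b.continuous_normed (μ := volume)) hf.locallyIntegrable :
            ConvolutionExists _ f _ volume) |> ae_of_all volume] with x hx
        rw [mollify_apply_swap]
        have := (B.flip (h x)).integral_comp_comm hx.integrable_swap
        simp only [ContinuousLinearMap.lsmul_apply, map_smul, ContinuousLinearMap.flip_apply] at this
        exact this.symm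
    _ = ∫ y, ∫ x, b.normed volume (x - y) • B (f y) (h x) := integral_integral_swap hint
    _ = ∫ y, B (f y) (mollify b h y) := by
        refine integral_congr_ae (ae_of_all _ fun y => ?_)
        dsimp only
        rw [mollify_apply_swap]
        have hx : Integrable (fun t => b.normed volume (y - t) • h t) volume :=
          ConvolutionExistsAt.integrable_swap (b.hasCompactSupport_normed.convolutionExists_left
            (ContinuousLinearMap.lsmul ℝ ℝ) b.continuous_normed hhi y)
        have := (B (f y)).integral_comp_comm hx
        simp only [map_smul] at this
        rw [← this]
        refine integral_congr_ae (ae_of_all _ fun x => ?_)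
        dsimp only
        rw [← b.normed_neg, neg_sub]

theorem fderiv_mollify [CompleteSpace F] (hf : ContDiff ℝ 1 f) (hs : HasCompactSupport f)
    (x : EuclideanSpace ℝ (Fin m)) : fderiv ℝ (mollify b f) x = mollify b (fderiv ℝ f) x := by
  have h := (hs.hasFDerivAt_convolution_right (ContinuousLinearMap.lsmul ℝ ℝ)
    ((b.continuous_normed (μ := volume)).locallyIntegrable (μ := volume)) hf x).fderiv
  rw [mollify, h]
  rfl

end Mollify

/-- The divergence of `ψ` is a linear function of its derivative, the trace. -/
noncomputable def traceCLM (m : ℕ) :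
    (EuclideanSpace ℝ (Fin m) →L[ℝ] EuclideanSpace ℝ (Fin m)) →L[ℝ] ℝ :=
  ∑ i, (EuclideanSpace.proj i).comp
    (ContinuousLinearMap.apply ℝ (EuclideanSpace ℝ (Fin m)) (EuclideanSpace.single i (1 : ℝ)))

theorem divergence_eq_traceCLM {m : ℕ} (ψ : EuclideanSpace ℝ (Fin m) → EuclideanSpace ℝ (Fin m))
    (x : EuclideanSpace ℝ (Fin m)) : divergence ψ x = traceCLM m (fderiv ℝ ψ x) := by
  simp [divergence, traceCLM]

section Divergence

variable {m : ℕ} {Ω : Set (EuclideanSpace ℝ (Fin m))}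
  {ψ ψ' : EuclideanSpace ℝ (Fin m) → EuclideanSpace ℝ (Fin m)}

theorem continuous_divergence (hψ : ContDiff ℝ 1 ψ) : Continuous (divergence ψ) := by
  have : divergence ψ = fun x => traceCLM m (fderiv ℝ ψ x) := funext (divergence_eq_traceCLM ψ)
  rw [this]
  exact (traceCLM m).continuous.comp (hψ.continuous_fderiv one_ne_zero)

theorem divergence_eq_zero {x : EuclideanSpace ℝ (Fin m)} (hx : x ∉ tsupport ψ) :
    divergence ψ x = 0 := by
  rw [divergence_eq_traceCLM, (notMem_tsupport_iff_eventuallyEq.1 hx).fderiv_eq]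
  simp

theorem tsupport_divergence_subset : tsupport (divergence ψ) ⊆ tsupport ψ :=
  closure_minimal (fun _ hx => by_contra fun h => hx (divergence_eq_zero h)) (isClosed_tsupport _)

theorem hasCompactSupport_divergence (h : HasCompactSupport ψ) :
    HasCompactSupport (divergence ψ) :=
  h.of_isClosed_subset (isClosed_tsupport _) tsupport_divergence_subset

theorem divergence_mollify (b : ContDiffBump (0 : EuclideanSpace ℝ (Fin m)))
    (hψ : ContDiff ℝ 1 ψ) (hs : HasCompactSupport ψ) (x : EuclideanSpace ℝ (Fin m)) :
    divergence (mollify b ψ) x = mollify b (divergence ψ) x := by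
  rw [divergence_eq_traceCLM, fderiv_mollify b hψ hs, mollify_apply, mollify_apply,
    ← ContinuousLinearMap.integral_comp_comm _ (integrable_normed_smul b
      (hψ.continuous_fderiv one_ne_zero).locallyIntegrable x)]
  simp [divergence_eq_traceCLM]

theorem divergence_sum {ι : Type*} (s : Finset ι)
    {ψ : ι → EuclideanSpace ℝ (Fin m) → EuclideanSpace ℝ (Fin m)}
    (h : ∀ i ∈ s, ContDiff ℝ 1 (ψ i)) (x : EuclideanSpace ℝ (Fin m)) :
    divergence (fun y => ∑ i ∈ s, ψ i y) x = ∑ i ∈ s, divergence (ψ i) x := by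
  rw [divergence_eq_traceCLM, fderiv_fun_sum fun i hi =>
    ((h i hi).differentiable one_ne_zero).differentiableAt, map_sum]
  simp [divergence_eq_traceCLM]

theorem divergence_smul {χ : EuclideanSpace ℝ (Fin m) → ℝ} {x : EuclideanSpace ℝ (Fin m)}
    (hχ : DifferentiableAt ℝ χ x) (hψ : DifferentiableAt ℝ ψ x) :
    divergence (fun y => χ y • ψ y) x = χ x * divergence ψ x + inner ℝ (gradient χ x) (ψ x) := by
  have h : fderiv ℝ χ x (ψ x) = inner ℝ (gradient χ x) (ψ x) := by
    rw [gradient, InnerProductSpace.toDual_symm_apply]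
  rw [← h, divergence_eq_traceCLM, fderiv_fun_smul hχ hψ, map_add, map_smul,
    ← divergence_eq_traceCLM, smul_eq_mul]
  congr 1
  have hx : ψ x = ∑ i, ψ x i • EuclideanSpace.single i (1 : ℝ) := by
    have := (EuclideanSpace.basisFun (Fin m) ℝ).sum_repr (ψ x)
    simpa using this.symm
  conv_rhs => rw [hx, map_sum]
  simp [traceCLM, mul_comm]

end Divergence

/-! ### Exhaustion of an open set by cutoff functions -/

theorem IsCutoff.mono {E : Type*} [NormedAddCommGroup E] [NormedSpace ℝ E] {Ω Ω' : Set E}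
    {χ : E → ℝ} (h : IsCutoff Ω χ) (hΩ : Ω ⊆ Ω') : IsCutoff Ω' χ :=
  { h with tsupport_subset := h.tsupport_subset.trans hΩ }

/-- A sequence of cutoff functions of `Ω` which exhausts `Ω`: it begins with `0`, each function is
`1` near the support of the previous one, and on each compact subset of `Ω` some function is `1`. -/
structure IsCutoffExhaustion {E : Type*} [NormedAddCommGroup E] [NormedSpace ℝ E] (Ω : Set E)
    (χ : ℕ → E → ℝ) : Prop where
  isCutoff : ∀ n, IsCutoff Ω (χ n)
  zero : χ 0 = 0
  succ_eq_one : ∀ n, ∀ᶠ x in 𝓝ˢ (tsupport (χ n)), χ (n + 1) x = 1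
  exists_eq_one : ∀ K, IsCompact K → K ⊆ Ω → ∃ n, ∀ᶠ x in 𝓝ˢ K, χ n x = 1

theorem exists_isCutoffExhaustion {E : Type*} [NormedAddCommGroup E] [NormedSpace ℝ E]
    [FiniteDimensional ℝ E] {Ω : Set E} (hΩ : IsOpen Ω) : ∃ χ, IsCutoffExhaustion Ω χ := by
  have : LocallyCompactSpace Ω := hΩ.locallyCompactSpace
  have : ProperSpace E := FiniteDimensional.proper ℝ E
  let K := CompactExhaustion.choice Ω
  let L : ℕ → Set E := fun n => Subtype.val '' K n
  have hL : ∀ n, IsCompact (L n) := fun n => (K.isCompact n).image continuous_subtype_val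
  have hLL : ∀ n, L n ⊆ interior (L (n + 1)) := fun n => by
    refine (image_mono (K.subset_interior_succ n)).trans (interior_maximal ?_ ?_)
    · exact image_mono interior_subset
    · exact hΩ.isOpenMap_subtype_val _ isOpen_interior
  have hLΩ : ∀ n, L n ⊆ Ω := fun n => by rintro _ ⟨x, -, rfl⟩; exact x.2
  choose χ hχ hχ1 using fun n =>
    exists_isCutoff_eventuallyEq_one (hL n) isOpen_interior (hLL n)
  refine ⟨fun n => Nat.casesOn n 0 χ, fun n => ?_, rfl, fun n => ?_, fun S hS hSΩ => ?_⟩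
  · cases n with
    | zero =>
      exact ⟨contDiff_const, HasCompactSupport.zero, by simp [tsupport], fun _ => le_rfl,
        fun _ => zero_le_one⟩
    | succ n => exact (hχ n).mono (interior_subset.trans (hLΩ _))
  · cases n with
    | zero => simp [tsupport]
    | succ n =>
      exact (hχ1 (n + 1)).filter_mono
        (nhdsSet_mono ((hχ n).tsupport_subset.trans interior_subset))
  · obtain ⟨n, hn⟩ := K.exists_superset_of_isCompact (s := Subtype.val ⁻¹' S)
      (Topology.IsInducing.subtypeVal.isCompact_preimage_iff (by simpa using hSΩ) |>.2 hS)
    refine ⟨n + 1, (hχ1 n).filter_mono (nhdsSet_mono fun x hx => ?_)⟩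
    exact ⟨⟨x, hSΩ hx⟩, hn hx, rfl⟩

namespace IsCutoffExhaustion

variable {E : Type*} [NormedAddCommGroup E] [NormedSpace ℝ E] {Ω : Set E} {χ : ℕ → E → ℝ}

theorem eq_one_of_ne_zero (h : IsCutoffExhaustion Ω χ) {n : ℕ} {x : E} (hx : χ n x ≠ 0) :
    χ (n + 1) x = 1 :=
  (h.succ_eq_one n).self_of_nhdsSet x (subset_tsupport _ hx)

theorem eq_one_of_lt (h : IsCutoffExhaustion Ω χ) {n k : ℕ} (hnk : n < k) {x : E}
    (hx : χ n x ≠ 0) : χ k x = 1 := by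
  induction k, hnk using Nat.le_induction with
  | base => exact h.eq_one_of_ne_zero hx
  | succ k _ ih => exact h.eq_one_of_ne_zero (by simp [ih])

theorem tsupport_mono (h : IsCutoffExhaustion Ω χ) {n k : ℕ} (hnk : n ≤ k) :
    tsupport (χ n) ⊆ tsupport (χ k) := by
  rcases hnk.eq_or_lt with rfl | hlt
  · exact le_rfl
  · exact closure_mono fun x hx => by simp [h.eq_one_of_lt hlt hx]

theorem exists_ne_zero (h : IsCutoffExhaustion Ω χ) {x : E} (hx : x ∈ Ω) :
    ∃ n, χ n x ≠ 0 := by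
  obtain ⟨n, hn⟩ := h.exists_eq_one {x} isCompact_singleton (by simpa using hx)
  exact ⟨n, by simp [hn.self_of_nhdsSet x rfl]⟩

theorem eventually_eq_one (h : IsCutoffExhaustion Ω χ) {x : E} (hx : x ∈ Ω) :
    ∀ᶠ n in atTop, χ n x = 1 := by
  obtain ⟨n, hn⟩ := h.exists_ne_zero hx
  filter_upwards [eventually_gt_atTop n] with k hk using h.eq_one_of_lt hk hn

end IsCutoffExhaustion

/-! ### Integration by parts for `C¹` functions on an open set -/

section ByParts

variable {m : ℕ} {Ω : Set (EuclideanSpace ℝ (Fin m))}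
  {ψ : EuclideanSpace ℝ (Fin m) → EuclideanSpace ℝ (Fin m)}
  {v : EuclideanSpace ℝ (Fin m) → ℝ}

theorem IsTestField.integral_mul_divergence (hψ : IsTestField Ω ψ)
    (v : EuclideanSpace ℝ (Fin m) → ℝ) :
    ∫ x in Ω, v x * divergence ψ x = ∫ x, v x * divergence ψ x := by
  refine setIntegral_eq_integral_of_forall_compl_eq_zero fun x hx => ?_
  rw [divergence_eq_zero fun h => hx (hψ.tsupport_subset h), mul_zero]

/-- A field which is smooth on `Ω` becomes a test field when it is cut off. -/
theorem IsCutoff.isTestField_smul_of_contDiffOn {χ : EuclideanSpace ℝ (Fin m) → ℝ}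
    (hΩ : IsOpen Ω) (hχ : IsCutoff Ω χ) (hψ : ContDiffOn ℝ (⊤ : ℕ∞) ψ Ω) :
    IsTestField Ω (fun x => χ x • ψ x) := by
  refine ⟨contDiff_iff_contDiffAt.2 fun x => ?_, hχ.hasCompactSupport.smul_right,
    (tsupport_smul_subset_left χ ψ).trans hχ.tsupport_subset⟩
  by_cases hx : x ∈ Ω
  · exact hχ.contDiff.contDiffAt.smul (hψ.contDiffAt (hΩ.mem_nhds hx))
  · have hx' : x ∉ tsupport χ := fun h => hx (hχ.tsupport_subset h)
    refine (contDiffAt_const (c := (0 : EuclideanSpace ℝ (Fin m)))).congr_of_eventuallyEq ?_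
    filter_upwards [notMem_tsupport_iff_eventuallyEq.1 hx'] with y hy
    simp [hy]

theorem integral_divergence_eq_zero (hψ : ContDiff ℝ 1 ψ) (hs : HasCompactSupport ψ) :
    ∫ x, divergence ψ x = 0 := by
  have hc : ∀ i : Fin m, Continuous fun x => (fderiv ℝ ψ x (EuclideanSpace.single i 1)) i :=
    fun i => (EuclideanSpace.proj (𝕜 := ℝ) i).continuous.comp
      ((hψ.continuous_fderiv one_ne_zero).clm_apply continuous_const)
  have hcs : ∀ i : Fin m, HasCompactSupport
      fun x => (fderiv ℝ ψ x (EuclideanSpace.single i 1)) i := fun i =>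
    (hs.fderiv ℝ).comp_left (g := fun A : EuclideanSpace ℝ (Fin m) →L[ℝ] EuclideanSpace ℝ (Fin m) =>
      (A (EuclideanSpace.single i 1)) i) (by simp)
  unfold divergence
  rw [integral_finsetSum _ fun i _ => (hc i).integrable_of_hasCompactSupport (hcs i)]
  refine Finset.sum_eq_zero fun i _ => ?_
  let p : EuclideanSpace ℝ (Fin m) →L[ℝ] ℝ := EuclideanSpace.proj i
  have hf : ∀ x, HasFDerivAt (fun y => ψ y i) (p.comp (fderiv ℝ ψ x)) x := fun x =>
    p.hasFDerivAt.comp x (hψ.differentiable one_ne_zero x).hasFDerivAt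
  have hd : ∀ x, fderiv ℝ (fun y => ψ y i) x (EuclideanSpace.single i 1)
      = (fderiv ℝ ψ x (EuclideanSpace.single i 1)) i := fun x => by rw [(hf x).fderiv]; rfl
  have hcψ : Continuous fun y => ψ y i := p.continuous.comp hψ.continuous
  have hsψ : HasCompactSupport fun y => ψ y i :=
    hs.comp_left (g := fun z : EuclideanSpace ℝ (Fin m) => z i) (by simp)
  have := integral_mul_fderiv_eq_neg_fderiv_mul_of_integrable (μ := volume)
    (f := fun _ : EuclideanSpace ℝ (Fin m) => (1 : ℝ)) (g := fun y => ψ y i)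
    (v := EuclideanSpace.single i 1) (by simp)
    (by simpa [hd] using (hc i).integrable_of_hasCompactSupport (hcs i))
    (by simpa using hcψ.integrable_of_hasCompactSupport hsψ)
    (fun x _ => differentiableAt_const _) (fun x _ => (hf x).differentiableAt)
  simpa [hd] using this

theorem continuousOn_gradient (hΩ : IsOpen Ω) (hv : ContDiffOn ℝ 1 v Ω) :
    ContinuousOn (gradient v) Ω :=
  (InnerProductSpace.toDual ℝ (EuclideanSpace ℝ (Fin m))).symm.continuous.comp_continuousOn
    (hv.continuousOn_fderiv_of_isOpen hΩ le_rfl)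

theorem contDiffOn_gradient (hΩ : IsOpen Ω) (hv : ContDiffOn ℝ (⊤ : ℕ∞) v Ω) :
    ContDiffOn ℝ (⊤ : ℕ∞) (gradient v) Ω :=
  (InnerProductSpace.toDual ℝ (EuclideanSpace ℝ (Fin m))).symm.contDiff.comp_contDiffOn
    (hv.fderiv_of_isOpen hΩ (by simp))

/-- The gradient of a `C¹` function on `Ω` is its distributional gradient. -/
theorem integral_mul_divergence_eq_neg (hΩ : IsOpen Ω) (hv : ContDiffOn ℝ 1 v Ω)
    (hψ : IsTestField Ω ψ) :
    ∫ x in Ω, v x * divergence ψ x = -∫ x in Ω, inner ℝ (ψ x) (gradient v x) := by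
  have hψ1 : ContDiff ℝ 1 ψ := hψ.contDiff.of_le (by exact_mod_cast le_top)
  have hts : tsupport (fun x => v x • ψ x) ⊆ tsupport ψ := tsupport_smul_subset_right v ψ
  have hW : ContDiff ℝ 1 fun x => v x • ψ x := contDiff_iff_contDiffAt.2 fun x => by
    by_cases hx : x ∈ Ω
    · exact (hv.contDiffAt (hΩ.mem_nhds hx)).smul hψ1.contDiffAt
    · have hx' : x ∉ tsupport ψ := fun h => hx (hψ.tsupport_subset h)
      refine (contDiffAt_const (c := (0 : EuclideanSpace ℝ (Fin m)))).congr_of_eventuallyEq ?_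
      filter_upwards [notMem_tsupport_iff_eventuallyEq.1 hx'] with y hy
      simp [hy]
  have hWs : HasCompactSupport fun x => v x • ψ x :=
    hψ.hasCompactSupport.of_isClosed_subset (isClosed_tsupport _) hts
  have h0 := integral_divergence_eq_zero hW hWs
  have hΩ0 : ∫ x in Ω, divergence (fun x => v x • ψ x) x = 0 := by
    rw [← h0]
    exact setIntegral_eq_integral_of_forall_compl_eq_zero fun x hx =>
      divergence_eq_zero fun h => hx (hψ.tsupport_subset (hts h))
  have hcongr : ∫ x in Ω, divergence (fun x => v x • ψ x) x
      = ∫ x in Ω, (v x * divergence ψ x + inner ℝ (ψ x) (gradient v x)) := by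
    refine setIntegral_congr_fun hΩ.measurableSet fun x hx => ?_
    rw [divergence_smul ((hv.contDiffAt (hΩ.mem_nhds hx)).differentiableAt one_ne_zero)
      (hψ1.differentiable one_ne_zero x), real_inner_comm]
  have hK := hψ.hasCompactSupport.isCompact
  have hint1 : IntegrableOn (fun x => v x * divergence ψ x) Ω := by
    refine (integrableOn_iff_integrable_of_support_subset (s := tsupport ψ) ?_ |>.1 ?_).integrableOn
    · exact fun x hx => by_contra fun h => hx (by simp [divergence_eq_zero h])
    · exact ((hv.continuousOn.mono hψ.tsupport_subset).mul
        (continuous_divergence hψ1).continuousOn).integrableOn_compact hK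
  have hint2 : IntegrableOn (fun x => inner ℝ (ψ x) (gradient v x)) Ω := by
    refine (integrableOn_iff_integrable_of_support_subset (s := tsupport ψ) ?_ |>.1 ?_).integrableOn
    · exact fun x hx => by_contra fun h => hx (by simp [image_eq_zero_of_notMem_tsupport h])
    · exact (hψ.contDiff.continuous.continuousOn.inner
        ((continuousOn_gradient hΩ hv).mono hψ.tsupport_subset)).integrableOn_compact hK
  rw [hcongr, integral_add hint1 hint2] at hΩ0
  linarith

/-- A `C¹` function with integrable gradient has a distributional gradient, whose density is the
classical gradient. -/
theorem isDistribGradient_withDensity (hΩ : IsOpen Ω) (hv : ContDiffOn ℝ 1 v Ω)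
    (hg : IntegrableOn (gradient v) Ω) :
    IsDistribGradient Ω v ((volume.restrict Ω).withDensityᵥ (gradient v)) := by
  refine ⟨?_, ?_, fun ψ h1 h2 h3 => ?_⟩
  · rw [Measure.variation_withDensityᵥ hg]
    simpa using! hg.2
  · ext1 s hs
    rw [VectorMeasure.restrict_apply _ hΩ.measurableSet hs, withDensityᵥ_apply hg hs,
      withDensityᵥ_apply hg (hs.inter hΩ.measurableSet),
      Measure.restrict_restrict hs, Measure.restrict_restrict (hs.inter hΩ.measurableSet),
      inter_assoc, inter_self]
  · obtain ⟨C, hC⟩ := h2.exists_bound_of_continuous h1.continuous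
    rw [integral_mul_divergence_eq_neg hΩ hv ⟨h1, h2, h3⟩,
      pairing_withDensity hg h1.continuous.measurable hC]

theorem enorm_integral_inner_le (hψ : ∀ x, ‖ψ x‖ ≤ 1)
    (g : EuclideanSpace ℝ (Fin m) → EuclideanSpace ℝ (Fin m)) :
    ENNReal.ofReal (∫ x in Ω, inner ℝ (ψ x) (g x)) ≤ ∫⁻ x in Ω, ‖g x‖ₑ := by
  refine (Real.ofReal_le_enorm _).trans ((enorm_integral_le_lintegral_enorm _).trans ?_)
  refine lintegral_mono fun x => ?_
  rw [← ofReal_norm, ← ofReal_norm]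
  refine ENNReal.ofReal_le_ofReal ((norm_inner_le_norm _ _).trans ?_)
  exact mul_le_of_le_one_left (norm_nonneg _) (hψ x)

/-- For a `C¹` function, the mass of the distributional gradient is at most the `L¹` norm of the
classical gradient. -/
theorem IsDistribGradient.variation_le_lintegral
    {μ : VectorMeasure (EuclideanSpace ℝ (Fin m)) (EuclideanSpace ℝ (Fin m))}
    (hΩ : IsOpen Ω) (hv : ContDiffOn ℝ 1 v Ω) (hμ : IsDistribGradient Ω v μ) :
    μ.variation Ω ≤ ∫⁻ x in Ω, ‖gradient v x‖ₑ := by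
  have : IsFiniteMeasure μ.variation := ⟨hμ.finite⟩
  refine variation_le_of_forall_isTestField hΩ hμ.concentrated fun ψ hψ hψ1 => ?_
  have h := hμ.integral_div ψ hψ.contDiff hψ.hasCompactSupport hψ.tsupport_subset
  rw [integral_mul_divergence_eq_neg hΩ hv hψ, neg_inj] at h
  rw [← h]
  exact enorm_integral_inner_le hψ1 _

/-- The `L¹` norm of the gradient of a smooth function on `Ω` is controlled by duality with test
fields: these may be taken close to the direction of the gradient. -/
theorem lintegral_gradient_le_of_forall_isTestField (hΩ : IsOpen Ω)
    (hv : ContDiffOn ℝ (⊤ : ℕ∞) v Ω) {C : ℝ}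
    (h : ∀ ψ, IsTestField Ω ψ → (∀ x, ‖ψ x‖ ≤ 1) → ∫ x in Ω, v x * divergence ψ x ≤ C) :
    ∫⁻ x in Ω, ‖gradient v x‖ₑ ≤ ENNReal.ofReal C := by
  have hv1 : ContDiffOn ℝ 1 v Ω := hv.of_le (by exact_mod_cast le_top)
  have hgc := continuousOn_gradient hΩ hv1
  have hgs := contDiffOn_gradient hΩ hv
  obtain ⟨χ, hχ⟩ := exists_isCutoffExhaustion hΩ
  have hint : ∀ n, IntegrableOn (fun x => χ n x * ‖gradient v x‖) Ω := fun n => by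
    refine (integrableOn_iff_integrable_of_support_subset (s := tsupport (χ n)) ?_ |>.1
      ?_).integrableOn
    · exact fun x hx => by_contra fun h => hx (by simp [image_eq_zero_of_notMem_tsupport h])
    · exact ((hχ.isCutoff n).contDiff.continuous.continuousOn.mul
        (hgc.mono (hχ.isCutoff n).tsupport_subset).norm).integrableOn_compact
        (hχ.isCutoff n).hasCompactSupport.isCompact
  have hχi : ∀ n, IntegrableOn (χ n) Ω := fun n =>
    ((hχ.isCutoff n).contDiff.continuous.integrable_of_hasCompactSupport
      (hχ.isCutoff n).hasCompactSupport).integrableOn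
  have key : ∀ n, ∀ δ : ℝ, 0 < δ →
      ∫ x in Ω, χ n x * ‖gradient v x‖ ≤ C + δ * ∫ x in Ω, χ n x := by
    intro n δ hδ
    set g := gradient v
    set N : EuclideanSpace ℝ (Fin m) → ℝ := fun x => Real.sqrt (‖g x‖ ^ 2 + δ ^ 2)
    have hNpos : ∀ x, 0 < N x := fun x => Real.sqrt_pos.2 (by positivity)
    have hNsq : ∀ x, N x ^ 2 = ‖g x‖ ^ 2 + δ ^ 2 := fun x => Real.sq_sqrt (by positivity)
    have hNg : ∀ x, ‖g x‖ ≤ N x := fun x => Real.le_sqrt_of_sq_le (by nlinarith)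
    have hNs : ContDiffOn ℝ (⊤ : ℕ∞) N Ω :=
      ((hgs.norm_sq ℝ).add contDiffOn_const).sqrt fun x _ => by positivity
    have hψ : IsTestField Ω fun x => χ n x • (-((N x)⁻¹ • g x)) :=
      (hχ.isCutoff n).isTestField_smul_of_contDiffOn hΩ
        ((hNs.inv fun x _ => (hNpos x).ne').smul hgs).neg
    have hψ1 : ∀ x, ‖χ n x • (-((N x)⁻¹ • g x))‖ ≤ 1 := fun x => by
      rw [norm_smul, norm_neg, norm_smul, norm_inv, Real.norm_of_nonneg ((hχ.isCutoff n).nonneg x),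
        Real.norm_of_nonneg (hNpos x).le]
      refine mul_le_one₀ ((hχ.isCutoff n).le_one x) (by positivity) ?_
      rw [inv_mul_le_iff₀ (hNpos x), mul_one]
      exact hNg x
    have h1 := h _ hψ hψ1
    rw [integral_mul_divergence_eq_neg hΩ hv1 hψ, ← integral_neg] at h1
    have hpt : ∀ x, χ n x * ‖g x‖ ≤
        -inner ℝ (χ n x • (-((N x)⁻¹ • g x))) (g x) + δ * χ n x := fun x => by
      rw [real_inner_smul_left, inner_neg_left, real_inner_smul_left, real_inner_self_eq_norm_sq]
      have h3 : ‖g x‖ ≤ (N x)⁻¹ * ‖g x‖ ^ 2 + δ := by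
        have h4 : ‖g x‖ ^ 2 = N x * N x - δ * δ := by nlinarith [hNsq x]
        have h5 : δ ≤ N x := Real.le_sqrt_of_sq_le (by nlinarith [norm_nonneg (g x)])
        have h6 : (N x)⁻¹ * (δ * δ) ≤ δ := by
          rw [inv_mul_le_iff₀ (hNpos x)]; exact mul_le_mul_of_nonneg_right h5 hδ.le
        have h7 : (N x)⁻¹ * ‖g x‖ ^ 2 = N x - (N x)⁻¹ * (δ * δ) := by
          rw [h4, mul_sub, inv_mul_cancel_left₀ (hNpos x).ne']
        linarith [hNg x]
      have h0 := (hχ.isCutoff n).nonneg x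
      nlinarith
    have hinn : IntegrableOn (fun x => -inner ℝ (χ n x • (-((N x)⁻¹ • g x))) (g x)) Ω := by
      refine (hint n).mono' ?_ (ae_of_all _ fun x => ?_)
      · exact ((hψ.contDiff.continuous.continuousOn.inner hgc).neg).aestronglyMeasurable
          hΩ.measurableSet
      · rw [norm_neg]
        refine (norm_inner_le_norm _ _).trans ?_
        gcongr
        rw [norm_smul, norm_neg, norm_smul, norm_inv,
          Real.norm_of_nonneg ((hχ.isCutoff n).nonneg x), Real.norm_of_nonneg (hNpos x).le]
        refine mul_le_of_le_one_right ((hχ.isCutoff n).nonneg x) ?_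
        rw [inv_mul_le_iff₀ (hNpos x), mul_one]
        exact hNg x
    calc ∫ x in Ω, χ n x * ‖g x‖
        ≤ ∫ x in Ω, (-inner ℝ (χ n x • (-((N x)⁻¹ • g x))) (g x) + δ * χ n x) :=
          integral_mono (hint n) (hinn.add ((hχi n).const_mul δ)) hpt
      _ = (∫ x in Ω, -inner ℝ (χ n x • (-((N x)⁻¹ • g x))) (g x)) + δ * ∫ x in Ω, χ n x := by
          rw [integral_add hinn ((hχi n).const_mul δ), integral_const_mul]
      _ ≤ _ := by gcongr
  have hC : ∀ n, ∫ x in Ω, χ n x * ‖gradient v x‖ ≤ C := fun n => by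
    have ht : Tendsto (fun δ : ℝ => C + δ * ∫ x in Ω, χ n x) (𝓝[>] 0)
        (𝓝 (C + 0 * ∫ x in Ω, χ n x)) :=
      ((tendsto_nhdsWithin_of_tendsto_nhds tendsto_id).mul_const _).const_add _
    rw [zero_mul, add_zero] at ht
    exact ge_of_tendsto ht (by filter_upwards [self_mem_nhdsWithin] with δ hδ using key n δ hδ)
  have hCn : ∀ n, ∫⁻ x in Ω, ENNReal.ofReal (χ n x * ‖gradient v x‖) ≤ ENNReal.ofReal C := fun n => by
    rw [← ofReal_integral_eq_lintegral_ofReal (hint n) (ae_of_all _ fun x =>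
      mul_nonneg ((hχ.isCutoff n).nonneg x) (norm_nonneg _))]
    exact ENNReal.ofReal_le_ofReal (hC n)
  calc ∫⁻ x in Ω, ‖gradient v x‖ₑ
      = ∫⁻ x in Ω, liminf (fun n => ENNReal.ofReal (χ n x * ‖gradient v x‖)) atTop := by
        refine setLIntegral_congr_fun hΩ.measurableSet fun x hx => ?_
        have : Tendsto (fun n => ENNReal.ofReal (χ n x * ‖gradient v x‖)) atTop
            (𝓝 ‖gradient v x‖ₑ) := by
          refine tendsto_const_nhds.congr' ?_
          filter_upwards [hχ.eventually_eq_one hx] with n hn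
          rw [hn, one_mul, ofReal_norm]
        exact this.liminf_eq.symm
    _ ≤ liminf (fun n => ∫⁻ x in Ω, ENNReal.ofReal (χ n x * ‖gradient v x‖)) atTop :=
        lintegral_liminf_le' fun n => (hint n).1.aemeasurable.ennreal_ofReal
    _ ≤ ENNReal.ofReal C := by
        refine (liminf_le_liminf (Eventually.of_forall hCn)).trans ?_
        simp

end ByParts

/-! ### Smooth approximation of functions of bounded variation -/

/-- The smooth partition of unity `χ (j + 1) - χ j` associated with an exhaustion. -/
def layer {E : Type*} (χ : ℕ → E → ℝ) (j : ℕ) (x : E) : ℝ := χ (j + 1) x - χ j x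

theorem sum_layer {E : Type*} (χ : ℕ → E → ℝ) (n : ℕ) (x : E) :
    ∑ j ∈ Finset.range n, layer χ j x = χ n x - χ 0 x :=
  Finset.sum_range_sub (fun j => χ j x) n

namespace IsCutoffExhaustion

theorem isCutoff_layer {E : Type*} [NormedAddCommGroup E] [NormedSpace ℝ E] {Ω : Set E}
    {χ : ℕ → E → ℝ} (h : IsCutoffExhaustion Ω χ) (j : ℕ) : IsCutoff Ω (layer χ j) := by
  have h1 := h.isCutoff (j + 1)
  have h0 := h.isCutoff j
  refine ⟨h1.contDiff.sub h0.contDiff, h1.hasCompactSupport.sub h0.hasCompactSupport,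
    (tsupport_sub _ _).trans (union_subset h1.tsupport_subset h0.tsupport_subset),
    fun x => ?_, fun x => ?_⟩
  · unfold layer
    by_cases hx : χ j x = 0
    · linarith [h1.nonneg x]
    · linarith [h.eq_one_of_ne_zero hx, h0.le_one x]
  · unfold layer
    linarith [h1.le_one x, h0.nonneg x]

variable {m : ℕ} {Ω : Set (EuclideanSpace ℝ (Fin m))} {χ : ℕ → EuclideanSpace ℝ (Fin m) → ℝ}

theorem gradient_layer (h : IsCutoffExhaustion Ω χ) (j : ℕ) (x : EuclideanSpace ℝ (Fin m)) :
    gradient (layer χ j) x = gradient (χ (j + 1)) x - gradient (χ j) x := by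
  have hd : ∀ n, DifferentiableAt ℝ (χ n) x := fun n =>
    ((h.isCutoff n).contDiff.differentiable (by simp)).differentiableAt
  unfold gradient
  rw [← map_sub, ← fderiv_sub (hd _) (hd _)]
  rfl

/-- Near the support of `χ n` only the first `n + 1` layers are active. -/
theorem exists_forall_layer_eq_zero (h : IsCutoffExhaustion Ω χ) (n : ℕ) :
    ∃ r > 0, ∀ x ∈ tsupport (χ n), ∀ y ∈ Metric.ball x r, layer χ (n + 1) y = 0 := by
  obtain ⟨U, hU, hUs, hU1⟩ := mem_nhdsSet_iff_exists.1 (h.succ_eq_one n)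
  obtain ⟨r, hr, hrU⟩ := (h.isCutoff n).hasCompactSupport.isCompact.exists_thickening_subset_open
    hU hUs
  refine ⟨r, hr, fun x hx y hy => ?_⟩
  have h1 : χ (n + 1) y = 1 := hU1 (hrU (Metric.mem_thickening_iff.2 ⟨x, hx, hy⟩))
  have h2 : χ (n + 2) y = 1 := h.eq_one_of_ne_zero (by simp [h1])
  simp [layer, h1, h2]

end IsCutoffExhaustion

section Glue

variable {m : ℕ} {Ω : Set (EuclideanSpace ℝ (Fin m))} {χ : ℕ → EuclideanSpace ℝ (Fin m) → ℝ}
  {u : EuclideanSpace ℝ (Fin m) → ℝ} {b : ℕ → ContDiffBump (0 : EuclideanSpace ℝ (Fin m))}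
  {ε : ℕ → ℝ}

/-- The sum of the mollifications of the localized functions `layer χ j * u`, the mollification
radius depending on the layer. -/
noncomputable def gluedMollify (χ : ℕ → EuclideanSpace ℝ (Fin m) → ℝ)
    (b : ℕ → ContDiffBump (0 : EuclideanSpace ℝ (Fin m))) (u : EuclideanSpace ℝ (Fin m) → ℝ)
    (x : EuclideanSpace ℝ (Fin m)) : ℝ :=
  ∑' j, mollify (b j) (fun y => layer χ j y * u y) x

/-- The mollification radii are so small that the localized functions, and the products of `u` with
the gradients of the partition of unity, change by at most `ε j` in `L¹`, and that the glued sum is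
locally finite. -/
structure IsFineMollification (χ : ℕ → EuclideanSpace ℝ (Fin m) → ℝ)
    (u : EuclideanSpace ℝ (Fin m) → ℝ) (ε : ℕ → ℝ)
    (b : ℕ → ContDiffBump (0 : EuclideanSpace ℝ (Fin m))) : Prop where
  integral_sub_le : ∀ j, ∫ x, ‖mollify (b j) (fun y => layer χ j y * u y) x - layer χ j x * u x‖ ≤ ε j
  integral_gradient_sub_le : ∀ j, ∫ x, ‖mollify (b j) (fun y => u y • gradient (layer χ j) y) x
    - u x • gradient (layer χ j) x‖ ≤ ε j
  eq_zero : ∀ n, ∀ x ∈ tsupport (χ n),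
    mollify (b (n + 1)) (fun y => layer χ (n + 1) y * u y) x = 0

theorem IsCutoff.integrable_mul {ζ : EuclideanSpace ℝ (Fin m) → ℝ} (hζ : IsCutoff Ω ζ)
    (hu : Integrable u volume) : Integrable (fun x => ζ x * u x) volume :=
  hu.bdd_mul hζ.contDiff.continuous.aestronglyMeasurable (c := 1) (ae_of_all _ fun x => by
    rw [Real.norm_of_nonneg (hζ.nonneg x)]; exact hζ.le_one x)

theorem IsCutoff.continuous_gradient {ζ : EuclideanSpace ℝ (Fin m) → ℝ} (hζ : IsCutoff Ω ζ) :
    Continuous (gradient ζ) :=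
  (InnerProductSpace.toDual ℝ (EuclideanSpace ℝ (Fin m))).symm.continuous.comp
    (hζ.contDiff.continuous_fderiv (by simp))

theorem IsCutoff.integrable_smul_gradient {ζ : EuclideanSpace ℝ (Fin m) → ℝ} (hζ : IsCutoff Ω ζ)
    (hu : Integrable u volume) : Integrable (fun x => u x • gradient ζ x) volume := by
  have hs : HasCompactSupport (gradient ζ) := (hζ.hasCompactSupport.fderiv ℝ).comp_left
    (g := (InnerProductSpace.toDual ℝ (EuclideanSpace ℝ (Fin m))).symm) (map_zero _)
  obtain ⟨C, hC⟩ := hs.exists_bound_of_continuous hζ.continuous_gradient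
  exact hu.smul_bdd C hζ.continuous_gradient.aestronglyMeasurable (ae_of_all _ hC)

theorem exists_isFineMollification (hχ : IsCutoffExhaustion Ω χ) (hu : Integrable u volume)
    (hε : ∀ j, 0 < ε j) : ∃ b, IsFineMollification χ u ε b := by
  have hj : ∀ j, ∃ b : ContDiffBump (0 : EuclideanSpace ℝ (Fin m)),
      ∫ x, ‖mollify b (fun y => layer χ j y * u y) x - layer χ j x * u x‖ ≤ ε j ∧
      ∫ x, ‖mollify b (fun y => u y • gradient (layer χ j) y) x
        - u x • gradient (layer χ j) x‖ ≤ ε j ∧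
      ∀ n, j = n + 1 → ∀ x ∈ tsupport (χ n), mollify b (fun y => layer χ j y * u y) x = 0 := by
    intro j
    obtain ⟨r₁, hr₁, h₁⟩ := exists_forall_integral_norm_mollify_sub_le
      ((hχ.isCutoff_layer j).integrable_mul hu) (hε j)
    obtain ⟨r₂, hr₂, h₂⟩ := exists_forall_integral_norm_mollify_sub_le
      ((hχ.isCutoff_layer j).integrable_smul_gradient hu) (hε j)
    obtain ⟨r₃, hr₃, h₃⟩ := hχ.exists_forall_layer_eq_zero (j - 1)
    set r := min r₁ (min r₂ r₃)
    have hr : 0 < r := by positivity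
    have hb : r / 2 < r := half_lt_self hr
    refine ⟨⟨r / 4, r / 2, by positivity, by linarith⟩, h₁ _ (hb.trans_le (min_le_left _ _)),
      h₂ _ (hb.trans_le ((min_le_right _ _).trans (min_le_left _ _))), ?_⟩
    rintro n rfl x hx
    refine mollify_eq_zero _ fun y hy => ?_
    have hy' : y ∈ Metric.ball x r₃ := Metric.ball_subset_ball
      (hb.le.trans ((min_le_right _ _).trans (min_le_right _ _))) hy
    rw [show n + 1 - 1 = n by omega] at h₃
    rw [h₃ x hx y hy', zero_mul]
  choose b h1 h2 h3 using hj
  exact ⟨b, h1, h2, fun n => h3 (n + 1) n rfl⟩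

namespace IsFineMollification

theorem gluedMollify_eq_sum (hχ : IsCutoffExhaustion Ω χ) (hb : IsFineMollification χ u ε b)
    {n : ℕ} {x : EuclideanSpace ℝ (Fin m)} (hx : x ∈ tsupport (χ n)) :
    gluedMollify χ b u x =
      ∑ j ∈ Finset.range (n + 1), mollify (b j) (fun y => layer χ j y * u y) x := by
  refine tsum_eq_sum fun j hj => ?_
  obtain ⟨k, rfl⟩ : ∃ k, j = k + 1 := ⟨j - 1, by simp at hj; omega⟩
  exact hb.eq_zero k x (hχ.tsupport_mono (by simp at hj; omega) hx)

theorem contDiffOn_gluedMollify (hχ : IsCutoffExhaustion Ω χ) (hu : Integrable u volume)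
    (hb : IsFineMollification χ u ε b) : ContDiffOn ℝ (⊤ : ℕ∞) (gluedMollify χ b u) Ω := by
  intro x hx
  obtain ⟨n, hn⟩ := hχ.exists_ne_zero hx
  have hs : ContDiff ℝ (⊤ : ℕ∞) fun z =>
      ∑ j ∈ Finset.range (n + 1), mollify (b j) (fun y => layer χ j y * u y) z :=
    ContDiff.sum fun j _ => contDiff_mollify _
      ((hχ.isCutoff_layer j).integrable_mul hu).locallyIntegrable
  refine (hs.contDiffAt.congr_of_eventuallyEq ?_).contDiffWithinAt
  filter_upwards [(hχ.isCutoff n).contDiff.continuous.continuousAt.eventually_ne hn] with y hy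
  exact hb.gluedMollify_eq_sum hχ (subset_tsupport _ hy)

theorem lintegral_gluedMollify_sub_le (hΩ : IsOpen Ω) (hχ : IsCutoffExhaustion Ω χ)
    (hu : Integrable u volume) (hb : IsFineMollification χ u ε b) :
    ∫⁻ x in Ω, ‖gluedMollify χ b u x - u x‖ₑ ≤ ∑' j, ENNReal.ofReal (ε j) := by
  have hi : ∀ j, Integrable (fun x => mollify (b j) (fun y => layer χ j y * u y) x
      - layer χ j x * u x) volume := fun j =>
    (integrable_mollify (b j) ((hχ.isCutoff_layer j).integrable_mul hu)).sub
      ((hχ.isCutoff_layer j).integrable_mul hu)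
  calc ∫⁻ x in Ω, ‖gluedMollify χ b u x - u x‖ₑ
      ≤ ∫⁻ x in Ω, ∑' j, ‖mollify (b j) (fun y => layer χ j y * u y) x - layer χ j x * u x‖ₑ := by
        refine setLIntegral_mono' hΩ.measurableSet fun x hx => ?_
        obtain ⟨n, hn⟩ := hχ.exists_ne_zero hx
        have h1 : ∑ j ∈ Finset.range (n + 1), layer χ j x = 1 := by
          rw [sum_layer, hχ.zero, hχ.eq_one_of_ne_zero hn]; simp
        have e : gluedMollify χ b u x - u x = ∑ j ∈ Finset.range (n + 1),
            (mollify (b j) (fun y => layer χ j y * u y) x - layer χ j x * u x) := by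
          rw [hb.gluedMollify_eq_sum hχ (subset_tsupport _ hn), Finset.sum_sub_distrib,
            ← Finset.sum_mul, h1, one_mul]
        rw [e]
        exact (enorm_sum_le _ _).trans (ENNReal.sum_le_tsum _)
    _ ≤ ∫⁻ x, ∑' j, ‖mollify (b j) (fun y => layer χ j y * u y) x - layer χ j x * u x‖ₑ :=
        setLIntegral_le_lintegral _ _
    _ = ∑' j, ∫⁻ x, ‖mollify (b j) (fun y => layer χ j y * u y) x - layer χ j x * u x‖ₑ :=
        lintegral_tsum fun j => (hi j).1.enorm
    _ ≤ ∑' j, ENNReal.ofReal (ε j) := by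
        refine ENNReal.tsum_le_tsum fun j => ?_
        rw [← ofReal_integral_norm_eq_lintegral_enorm (hi j)]
        exact ENNReal.ofReal_le_ofReal (hb.integral_sub_le j)

/-- The duality estimate for the glued mollification. Moving the mollifications to the test field
`ψ` gives the pairing of `Du` with the field `∑ j, layer χ j • mollify (b j) ψ`, which is a convex
combination of fields in the unit ball; the remaining terms, in which derivatives fall on the
partition of unity, cancel up to the mollification errors because the partition sums to `1`. -/
theorem integral_gluedMollify_mul_divergence_le (hχ : IsCutoffExhaustion Ω χ)
    (hu : Integrable u volume) (hb : IsFineMollification χ u ε b) {M : ℝ}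
    (hM : ∀ ψ, IsTestField Ω ψ → (∀ x, ‖ψ x‖ ≤ 1) → ∫ x, u x * divergence ψ x ≤ M)
    {ψ : EuclideanSpace ℝ (Fin m) → EuclideanSpace ℝ (Fin m)} (hψ : IsTestField Ω ψ)
    (hψ1 : ∀ x, ‖ψ x‖ ≤ 1) :
    ∃ N, ∫ x in Ω, gluedMollify χ b u x * divergence ψ x ≤ M + ∑ j ∈ Finset.range N, ε j := by
  have hψC : ContDiff ℝ 1 ψ := hψ.contDiff.of_le (by exact_mod_cast le_top)
  obtain ⟨n, hn⟩ := hχ.exists_eq_one _ hψ.hasCompactSupport.isCompact hψ.tsupport_subset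
  have hsub : tsupport ψ ⊆ tsupport (χ n) := fun x hx =>
    subset_tsupport _ (by simp [hn.self_of_nhdsSet x hx])
  set N := n + 1
  refine ⟨N, ?_⟩
  have hζ := hχ.isCutoff_layer
  have hf := fun j => (hζ j).integrable_mul hu
  have hG := fun j => (hζ j).integrable_smul_gradient hu
  have hdc := continuous_divergence hψC
  have hds := hasCompactSupport_divergence hψ.hasCompactSupport
  set ψm : ℕ → EuclideanSpace ℝ (Fin m) → EuclideanSpace ℝ (Fin m) := fun j => mollify (b j) ψ
  have hψm : ∀ j, ContDiff ℝ (⊤ : ℕ∞) (ψm j) := fun j =>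
    contDiff_mollify _ hψ.contDiff.continuous.locallyIntegrable
  have hψm1 : ∀ j x, ‖ψm j x‖ ≤ 1 := fun j =>
    norm_mollify_le _ hψ.contDiff.continuous.aestronglyMeasurable zero_le_one hψ1
  have hΨj : ∀ j, IsTestField Ω fun x => layer χ j x • ψm j x := fun j =>
    (hζ j).isTestField_smul (hψm j)
  have hΨ : IsTestField Ω fun x => ∑ j ∈ Finset.range N, layer χ j x • ψm j x :=
    IsTestField.sum _ fun j _ => hΨj j
  have hΨ1 : ∀ x, ‖∑ j ∈ Finset.range N, layer χ j x • ψm j x‖ ≤ 1 := fun x => by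
    calc ‖∑ j ∈ Finset.range N, layer χ j x • ψm j x‖
        ≤ ∑ j ∈ Finset.range N, layer χ j x := by
          refine (norm_sum_le _ _).trans (Finset.sum_le_sum fun j _ => ?_)
          rw [norm_smul, Real.norm_of_nonneg ((hζ j).nonneg x)]
          exact mul_le_of_le_one_right ((hζ j).nonneg x) (hψm1 j x)
      _ ≤ 1 := by
          rw [sum_layer]
          linarith [(hχ.isCutoff N).le_one x, (hχ.isCutoff 0).nonneg x]
  -- the sum of the main terms
  have hdivint : ∀ j, Integrable (fun x => u x * divergence (fun y => layer χ j y • ψm j y) x) := by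
    intro j
    have hc := continuous_divergence ((hΨj j).contDiff.of_le (by exact_mod_cast le_top))
    obtain ⟨C, hC⟩ := (hasCompactSupport_divergence (hΨj j).hasCompactSupport
      ).exists_bound_of_continuous hc
    exact hu.mul_bdd (c := C) hc.aestronglyMeasurable (ae_of_all _ hC)
  have hmain : ∑ j ∈ Finset.range N, ∫ x, u x * divergence (fun y => layer χ j y • ψm j y) x
      ≤ M := by
    rw [← integral_finsetSum _ fun j _ => hdivint j]
    refine le_trans (le_of_eq (integral_congr_ae (ae_of_all _ fun x => ?_))) (hM _ hΨ hΨ1)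
    dsimp only
    rw [divergence_sum _ fun j _ => (hΨj j).contDiff.of_le (by exact_mod_cast le_top),
      Finset.mul_sum]
  -- the sum of the terms with derivatives of the partition of unity
  have hinn : ∀ {g : EuclideanSpace ℝ (Fin m) → EuclideanSpace ℝ (Fin m)}
      {h : EuclideanSpace ℝ (Fin m) → EuclideanSpace ℝ (Fin m)}, Integrable g volume →
      Continuous h → (∀ x, ‖h x‖ ≤ 1) → Integrable (fun x => (inner ℝ (g x) (h x) : ℝ)) volume := by
    intro g h hg hh hh1
    refine hg.norm.mono' (hg.1.inner hh.aestronglyMeasurable) (ae_of_all _ fun x => ?_)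
    exact (norm_inner_le_norm _ _).trans (mul_le_of_le_one_right (norm_nonneg _) (hh1 x))
  have hψcont := hψ.contDiff.continuous
  have herr : ∀ j, -∫ x, inner ℝ (u x • gradient (layer χ j) x) (ψm j x)
      ≤ ε j - ∫ x, inner ℝ (u x • gradient (layer χ j) x) (ψ x) := by
    intro j
    have hMG := integrable_mollify (b j) (hG j)
    have h1 : ∫ x, inner ℝ (u x • gradient (layer χ j) x) (ψm j x)
        = ∫ x, inner ℝ (mollify (b j) (fun y => u y • gradient (layer χ j) y) x) (ψ x) :=
      (integral_mollify_comm (b j) (innerSL ℝ) (hG j) hψcont hψ.hasCompactSupport).symm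
    have h2 : (∫ x, inner ℝ (u x • gradient (layer χ j) x) (ψ x))
        - ∫ x, inner ℝ (mollify (b j) (fun y => u y • gradient (layer χ j) y) x) (ψ x)
        ≤ ε j := by
      rw [← integral_sub (hinn (hG j) hψcont hψ1) (hinn hMG hψcont hψ1)]
      refine le_trans (integral_mono ((hinn (hG j) hψcont hψ1).sub (hinn hMG hψcont hψ1))
        (hMG.sub (hG j)).norm fun x => ?_) (hb.integral_gradient_sub_le j)
      dsimp only
      rw [Pi.sub_apply, ← inner_sub_left, ← norm_neg, neg_sub]
      exact (real_inner_le_norm _ _).trans (mul_le_of_le_one_right (norm_nonneg _) (hψ1 x))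
    linarith
  have hcancel : ∑ j ∈ Finset.range N, ∫ x, inner ℝ (u x • gradient (layer χ j) x) (ψ x) = 0 := by
    rw [← integral_finsetSum _ fun j _ => hinn (hG j) hψcont hψ1]
    refine integral_eq_zero_of_ae (ae_of_all _ fun x => ?_)
    dsimp only
    rw [← sum_inner, ← Finset.smul_sum]
    by_cases hx : x ∈ tsupport ψ
    · have e : ∑ j ∈ Finset.range N, gradient (layer χ j) x = gradient (χ N) x - gradient (χ 0) x := by
        simp only [hχ.gradient_layer]
        exact Finset.sum_range_sub (fun j => gradient (χ j) x) N
      have hN : gradient (χ N) x = 0 := by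
        have hev : χ N =ᶠ[𝓝 x] fun _ => (1 : ℝ) :=
          (eventually_nhdsSet_iff_forall.1 (hχ.succ_eq_one n)) x (hsub hx)
        rw [gradient, hev.fderiv_eq]
        simp
      have h0 : gradient (χ 0) x = 0 := by
        rw [hχ.zero, gradient]; simp
      rw [e, hN, h0]
      simp
    · simp [image_eq_zero_of_notMem_tsupport hx]
  -- the product rule
  have hterm : ∀ j, ∫ x, mollify (b j) (fun y => layer χ j y * u y) x * divergence ψ x
      = (∫ x, u x * divergence (fun y => layer χ j y • ψm j y) x)
        + -∫ x, inner ℝ (u x • gradient (layer χ j) x) (ψm j x) := by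
    intro j
    have h1 : ∫ x, mollify (b j) (fun y => layer χ j y * u y) x * divergence ψ x
        = ∫ x, layer χ j x * u x * mollify (b j) (divergence ψ) x :=
      integral_mollify_comm (b j) (ContinuousLinearMap.mul ℝ ℝ) (hf j) hdc hds
    rw [h1, ← sub_eq_add_neg, ← integral_sub (hdivint j)
      (hinn (hG j) (hψm j).continuous (hψm1 j))]
    refine integral_congr_ae (ae_of_all _ fun x => ?_)
    dsimp only
    rw [divergence_smul ((hζ j).contDiff.differentiable (by simp) x)
      ((hψm j).differentiable (by simp) x), divergence_mollify (b j) hψC hψ.hasCompactSupport,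
      real_inner_smul_left]
    ring
  calc ∫ x in Ω, gluedMollify χ b u x * divergence ψ x
      = ∫ x, gluedMollify χ b u x * divergence ψ x := hψ.integral_mul_divergence _
    _ = ∫ x, ∑ j ∈ Finset.range N,
          mollify (b j) (fun y => layer χ j y * u y) x * divergence ψ x := by
        refine integral_congr_ae (ae_of_all _ fun x => ?_)
        dsimp only
        by_cases hx : x ∈ tsupport ψ
        · rw [hb.gluedMollify_eq_sum hχ (hsub hx), Finset.sum_mul]
        · simp [divergence_eq_zero hx]
    _ = ∑ j ∈ Finset.range N, ∫ x,
          mollify (b j) (fun y => layer χ j y * u y) x * divergence ψ x := by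
        refine integral_finsetSum _ fun j _ => ?_
        exact ((contDiff_mollify _ (hf j).locallyIntegrable).continuous.mul
          hdc).integrable_of_hasCompactSupport hds.mul_left
    _ = (∑ j ∈ Finset.range N, ∫ x, u x * divergence (fun y => layer χ j y • ψm j y) x)
        + ∑ j ∈ Finset.range N, -∫ x, inner ℝ (u x • gradient (layer χ j) x) (ψm j x) := by
        rw [← Finset.sum_add_distrib]
        exact Finset.sum_congr rfl fun j _ => hterm j
    _ ≤ M + ∑ j ∈ Finset.range N,
          (ε j - ∫ x, inner ℝ (u x • gradient (layer χ j) x) (ψ x)) :=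
        add_le_add hmain (Finset.sum_le_sum fun j _ => herr j)
    _ = M + ∑ j ∈ Finset.range N, ε j := by
        rw [Finset.sum_sub_distrib, hcancel, sub_zero]

end IsFineMollification

end Glue

theorem IsDistribGradient.variation_univ {m : ℕ} {Ω : Set (EuclideanSpace ℝ (Fin m))}
    {u : EuclideanSpace ℝ (Fin m) → ℝ}
    {μ : VectorMeasure (EuclideanSpace ℝ (Fin m)) (EuclideanSpace ℝ (Fin m))} (hΩ : IsOpen Ω)
    (hμ : IsDistribGradient Ω u μ) : μ.variation univ = μ.variation Ω := by
  conv_lhs => rw [← hμ.concentrated]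
  rw [VectorMeasure.variation_restrict hΩ.measurableSet, Measure.restrict_apply_univ]

/-- Functions of bounded variation are strict limits of smooth functions
(the Meyers–Serrin theorem in `BV`, due to Anzellotti and Giaquinta). -/
theorem IsDistribGradient.exists_contDiffOn_approx {m : ℕ} {Ω : Set (EuclideanSpace ℝ (Fin m))}
    {u : EuclideanSpace ℝ (Fin m) → ℝ}
    {μ : VectorMeasure (EuclideanSpace ℝ (Fin m)) (EuclideanSpace ℝ (Fin m))}
    (hΩ : IsOpen Ω) (hu : IntegrableOn u Ω) (hμ : IsDistribGradient Ω u μ) {δ : ℝ} (hδ : 0 < δ) :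
    ∃ v, ContDiffOn ℝ (⊤ : ℕ∞) v Ω ∧ ∫⁻ x in Ω, ‖v x - u x‖ₑ ≤ ENNReal.ofReal δ ∧
      ∫⁻ x in Ω, ‖gradient v x‖ₑ ≤ μ.variation Ω + ENNReal.ofReal δ := by
  have : IsFiniteMeasure μ.variation := ⟨hμ.finite⟩
  obtain ⟨χ, hχ⟩ := exists_isCutoffExhaustion hΩ
  have hu' : Integrable (Ω.indicator u) volume := hu.integrable_indicator hΩ.measurableSet
  set ε : ℕ → ℝ := fun j => δ / 2 / 2 ^ j
  have hε : ∀ j, 0 < ε j := fun j => by positivity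
  have hεs : Summable ε := summable_geometric_two' δ
  have hεt : ∑' j, ε j = δ := tsum_geometric_two' δ
  obtain ⟨b, hb⟩ := exists_isFineMollification hχ hu' hε
  refine ⟨gluedMollify χ b (Ω.indicator u), hb.contDiffOn_gluedMollify hχ hu', ?_, ?_⟩
  · have h := hb.lintegral_gluedMollify_sub_le hΩ hχ hu'
    rw [← ENNReal.ofReal_tsum_of_nonneg (fun j => (hε j).le) hεs, hεt] at h
    refine le_trans (le_of_eq (setLIntegral_congr_fun hΩ.measurableSet fun x hx => ?_)) h
    rw [indicator_of_mem hx]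
  · have hvar : μ.variation.real univ = (μ.variation Ω).toReal := by
      rw [measureReal_def, hμ.variation_univ hΩ]
    have hM : ∀ ψ, IsTestField Ω ψ → (∀ x, ‖ψ x‖ ≤ 1) →
        ∫ x, Ω.indicator u x * divergence ψ x ≤ (μ.variation Ω).toReal := fun ψ hψ hψ1 => by
      have h1 := hμ.integral_div ψ hψ.contDiff hψ.hasCompactSupport hψ.tsupport_subset
      have h2 : ∫ x, Ω.indicator u x * divergence ψ x = ∫ x in Ω, u x * divergence ψ x := by
        rw [← hψ.integral_mul_divergence]
        exact setIntegral_congr_fun hΩ.measurableSet fun x hx => by simp [indicator_of_mem hx]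
      have h3 := norm_pairing_le_integral_norm.trans (integral_norm_le_mul_variation (μ := μ) hψ1)
      rw [h2, h1, ← hvar]
      linarith [neg_le_abs (pairing μ ψ), Real.norm_eq_abs (pairing μ ψ)]
    have h := lintegral_gradient_le_of_forall_isTestField hΩ (hb.contDiffOn_gluedMollify hχ hu')
      (C := (μ.variation Ω).toReal + δ) fun ψ hψ hψ1 => by
        obtain ⟨N, hN⟩ := hb.integral_gluedMollify_mul_divergence_le hχ hu' hM hψ hψ1
        refine hN.trans (add_le_add le_rfl ?_)
        rw [← hεt]
        exact hεs.sum_le_tsum _ fun j _ => (hε j).le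
    rwa [ENNReal.ofReal_add ENNReal.toReal_nonneg hδ.le,
      ENNReal.ofReal_toReal (measure_ne_top _ _)] at h

/-! ### Concave functions with linear growth -/

section Concave

variable {φ : ℝ → ℝ} {φinf : ℝ}

/-- The quotients `φ t / t` decrease to their limit at infinity. -/
theorem mul_le_of_concaveOn_of_tendsto_div (hφ_concave : ConcaveOn ℝ (Ici 0) φ) (hφ_zero : φ 0 = 0)
    (hφ_lim : Tendsto (fun t => φ t / t) atTop (𝓝 φinf)) {t : ℝ} (ht : 0 ≤ t) : φinf * t ≤ φ t := by
  rcases ht.eq_or_lt with rfl | ht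
  · simp [hφ_zero]
  refine le_of_tendsto (hφ_lim.mul_const t) ?_
  filter_upwards [eventually_ge_atTop t] with T hT
  have hT0 : 0 < T := ht.trans_le hT
  have h := hφ_concave.2 (mem_Ici.2 le_rfl) (mem_Ici.2 hT0.le)
    (show 0 ≤ 1 - t / T by rw [sub_nonneg, div_le_one hT0]; exact hT)
    (show 0 ≤ t / T by positivity) (by ring)
  simp only [smul_eq_mul, hφ_zero, mul_zero, zero_add] at h
  rw [div_mul_cancel₀ t hT0.ne'] at h
  calc φ T / T * t = t / T * φ T := by ring
    _ ≤ φ t := h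

/-- Up to an additive constant, `φ` is almost linear with its slope at infinity. -/
theorem exists_forall_le_mul_add (hφ_nonneg : ∀ t, 0 ≤ t → 0 ≤ φ t)
    (hφ_concave : ConcaveOn ℝ (Ici 0) φ)
    (hφ_lim : Tendsto (fun t => φ t / t) atTop (𝓝 φinf)) (hφinf : 0 ≤ φinf) {ε : ℝ} (hε : 0 < ε) :
    ∃ C, 0 ≤ C ∧ ∀ t, 0 ≤ t → φ t ≤ (φinf + ε) * t + C := by
  obtain ⟨R, hR0, hR⟩ : ∃ R, 0 < R ∧ ∀ t, R ≤ t → φ t / t ≤ φinf + ε := by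
    have h := hφ_lim.eventually (ge_mem_nhds (show φinf < φinf + ε by linarith))
    obtain ⟨R, hR⟩ := eventually_atTop.1 h
    exact ⟨max R 1, by positivity, fun t ht => hR t ((le_max_left _ _).trans ht)⟩
  refine ⟨2 * φ R, by linarith [hφ_nonneg R hR0.le], fun t ht => ?_⟩
  rcases le_total R t with h | h
  · have h1 := hR t h
    rw [div_le_iff₀ (hR0.trans_le h)] at h1
    linarith [hφ_nonneg R hR0.le]
  · -- `R` is the midpoint of `t` and `2 R - t`
    have h1 := hφ_concave.2 (mem_Ici.2 ht) (mem_Ici.2 (show 0 ≤ 2 * R - t by linarith))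
      (show (0 : ℝ) ≤ 1 / 2 by norm_num) (show (0 : ℝ) ≤ 1 / 2 by norm_num) (by norm_num)
    have e : (1 / 2 : ℝ) • t + (1 / 2 : ℝ) • (2 * R - t) = R := by
      simp only [smul_eq_mul]; ring
    rw [e] at h1
    simp only [smul_eq_mul] at h1
    have h2 := hφ_nonneg (2 * R - t) (by linarith)
    have h3 : 0 ≤ (φinf + ε) * t := by positivity
    linarith

end Concave

/-! ### Superpositions with scalar functions -/

theorem hasDerivAt_integral_of_continuous {p : ℝ → ℝ} (hp : Continuous p) (s : ℝ) :
    HasDerivAt (fun t => ∫ r in (0 : ℝ)..t, p r) (p s) s :=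
  intervalIntegral.integral_hasDerivAt_right (hp.intervalIntegrable _ _)
    (hp.stronglyMeasurableAtFilter _ _) hp.continuousAt

theorem contDiff_one_of_hasDerivAt {H p : ℝ → ℝ} (hH : ∀ s, HasDerivAt H (p s) s)
    (hp : Continuous p) : ContDiff ℝ 1 H := by
  refine contDiff_one_iff_deriv.2 ⟨fun s => (hH s).differentiableAt, ?_⟩
  rwa [show deriv H = p from funext fun s => (hH s).deriv]

theorem gradient_comp_of_hasDerivAt {m : ℕ} {v : EuclideanSpace ℝ (Fin m) → ℝ}
    {x : EuclideanSpace ℝ (Fin m)} {H : ℝ → ℝ} {d : ℝ} (hH : HasDerivAt H d (v x))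
    (hv : DifferentiableAt ℝ v x) : gradient (fun y => H (v y)) x = d • gradient v x := by
  have h := (hH.comp_hasFDerivAt x hv.hasFDerivAt).fderiv
  rw [gradient, gradient, show (fun y => H (v y)) = H ∘ v from rfl, h]
  simp

section Superposition

variable {m : ℕ} {Ω : Set (EuclideanSpace ℝ (Fin m))} {v : EuclideanSpace ℝ (Fin m) → ℝ}
  {H p : ℝ → ℝ}

theorem integrableOn_gradient_comp (hΩ : IsOpen Ω) (hv : ContDiffOn ℝ 1 v Ω)
    (hg : IntegrableOn (gradient v) Ω) (hH : ∀ s, HasDerivAt H (p s) s) (hp : Continuous p) {C : ℝ}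
    (hC : ∀ s, |p s| ≤ C) : IntegrableOn (gradient fun y => H (v y)) Ω := by
  have hw : ContDiffOn ℝ 1 (fun y => H (v y)) Ω :=
    (contDiff_one_of_hasDerivAt hH hp).comp_contDiffOn hv
  refine (hg.norm.const_mul C).mono'
    ((continuousOn_gradient hΩ hw).aestronglyMeasurable hΩ.measurableSet) ?_
  filter_upwards [ae_restrict_mem hΩ.measurableSet] with x hx
  rw [gradient_comp_of_hasDerivAt (hH _)
    ((hv.contDiffAt (hΩ.mem_nhds hx)).differentiableAt one_ne_zero), norm_smul, Real.norm_eq_abs]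
  gcongr
  exact hC _

end Superposition

/-! ### Soft thresholding -/

/-- The derivative of the soft threshold: `0` on `[-δ, δ]` and `1` off `[-2δ, 2δ]`. -/
noncomputable def thresholdDeriv (δ r : ℝ) : ℝ := min 1 (max 0 (|r| / δ - 1))

/-- The soft threshold, a `C¹` approximation of the identity which vanishes on `[-δ, δ]`. -/
noncomputable def softThreshold (δ s : ℝ) : ℝ := ∫ r in (0 : ℝ)..s, thresholdDeriv δ r

theorem continuous_thresholdDeriv (δ : ℝ) : Continuous (thresholdDeriv δ) := by
  unfold thresholdDeriv; fun_prop

theorem thresholdDeriv_nonneg (δ r : ℝ) : 0 ≤ thresholdDeriv δ r :=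
  le_min zero_le_one (le_max_left _ _)

theorem thresholdDeriv_le_one (δ r : ℝ) : thresholdDeriv δ r ≤ 1 := min_le_left _ _

theorem thresholdDeriv_eq_zero {δ r : ℝ} (hδ : 0 < δ) (h : |r| ≤ δ) : thresholdDeriv δ r = 0 := by
  have : |r| / δ - 1 ≤ 0 := by rw [sub_nonpos, div_le_one hδ]; exact h
  rw [thresholdDeriv, max_eq_left this, min_eq_right zero_le_one]

theorem thresholdDeriv_eq_one {δ r : ℝ} (hδ : 0 < δ) (h : 2 * δ ≤ |r|) :
    thresholdDeriv δ r = 1 := by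
  have : 1 ≤ |r| / δ - 1 := by rw [le_sub_iff_add_le, le_div_iff₀ hδ]; linarith
  rw [thresholdDeriv, max_eq_right (by linarith), min_eq_left this]

theorem hasDerivAt_softThreshold (δ s : ℝ) :
    HasDerivAt (softThreshold δ) (thresholdDeriv δ s) s :=
  hasDerivAt_integral_of_continuous (continuous_thresholdDeriv δ) s

theorem softThreshold_eq_zero {δ s : ℝ} (hδ : 0 < δ) (h : |s| ≤ δ) : softThreshold δ s = 0 := by
  refine intervalIntegral.integral_zero_ae (ae_of_all _ fun r hr => thresholdDeriv_eq_zero hδ ?_)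
  have h2 : |r - 0| ≤ |s - 0| := abs_sub_left_of_mem_uIcc (uIoc_subset_uIcc hr)
  simp only [sub_zero] at h2
  exact h2.trans h

theorem softThreshold_sub_self (δ s : ℝ) :
    softThreshold δ s - s = ∫ r in (0 : ℝ)..s, (thresholdDeriv δ r - 1) := by
  rw [intervalIntegral.integral_sub ((continuous_thresholdDeriv δ).intervalIntegrable _ _)
    (by simp)]
  simp [softThreshold]

theorem abs_softThreshold_sub_le_abs (δ s : ℝ) : |softThreshold δ s - s| ≤ |s| := by
  rw [softThreshold_sub_self]
  have := intervalIntegral.norm_integral_le_of_norm_le_const (a := 0) (b := s) (C := 1)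
    (f := fun r => thresholdDeriv δ r - 1) fun r _ => by
      rw [Real.norm_eq_abs, abs_le]
      constructor <;> linarith [thresholdDeriv_nonneg δ r, thresholdDeriv_le_one δ r]
  simpa using this

theorem abs_softThreshold_sub_le {δ : ℝ} (hδ : 0 < δ) (s : ℝ) :
    |softThreshold δ s - s| ≤ 4 * δ := by
  rw [softThreshold_sub_self, ← Real.norm_eq_abs]
  refine intervalIntegral.norm_integral_le_integral_norm_uIoc.trans ?_
  have hI : Integrable ((Icc (-(2 * δ)) (2 * δ)).indicator fun _ => (1 : ℝ)) :=
    (integrableOn_const measure_Icc_lt_top.ne).integrable_indicator measurableSet_Icc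
  have hle : ∀ r, ‖thresholdDeriv δ r - 1‖ ≤
      (Icc (-(2 * δ)) (2 * δ)).indicator (fun _ => (1 : ℝ)) r := by
    intro r
    by_cases hr : r ∈ Icc (-(2 * δ)) (2 * δ)
    · rw [indicator_of_mem hr, Real.norm_eq_abs, abs_le]
      constructor <;> linarith [thresholdDeriv_nonneg δ r, thresholdDeriv_le_one δ r]
    · rw [indicator_of_notMem hr, thresholdDeriv_eq_one hδ]
      · simp
      · by_contra! h
        exact hr (abs_le.1 h.le)
  have hJ : Integrable fun r => thresholdDeriv δ r - 1 :=
    hI.mono' ((continuous_thresholdDeriv δ).sub continuous_const).aestronglyMeasurable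
      (ae_of_all _ hle)
  calc ∫ r in uIoc 0 s, ‖thresholdDeriv δ r - 1‖ ≤ ∫ r, ‖thresholdDeriv δ r - 1‖ :=
        setIntegral_le_integral hJ.norm (ae_of_all _ fun _ => norm_nonneg _)
    _ ≤ ∫ r, (Icc (-(2 * δ)) (2 * δ)).indicator (fun _ => (1 : ℝ)) r :=
        integral_mono hJ.norm hI hle
    _ = 4 * δ := by
        rw [integral_indicator measurableSet_Icc, setIntegral_const, smul_eq_mul, mul_one,
          Real.volume_real_Icc_of_le (by linarith)]
        ring

/-- A `C¹` function in `W^{1,1}(Ω)` can be approximated in `L¹` by soft thresholds, which vanish off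
a set of finite measure and have a smaller gradient. -/
theorem exists_approx_finite_measure {m : ℕ} {Ω : Set (EuclideanSpace ℝ (Fin m))}
    {v : EuclideanSpace ℝ (Fin m) → ℝ} (hΩ : IsOpen Ω) (hv : ContDiffOn ℝ 1 v Ω)
    (hi : IntegrableOn v Ω) (hg : IntegrableOn (gradient v) Ω) {ε : ℝ≥0∞} (hε : 0 < ε) :
    ∃ (w : EuclideanSpace ℝ (Fin m) → ℝ) (A : Set (EuclideanSpace ℝ (Fin m))),
      ContDiffOn ℝ 1 w Ω ∧ IntegrableOn (gradient w) Ω ∧ ∫⁻ x in Ω, ‖w x - v x‖ₑ ≤ ε ∧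
      ∫⁻ x in Ω, ‖gradient w x‖ₑ ≤ ∫⁻ x in Ω, ‖gradient v x‖ₑ ∧
      MeasurableSet A ∧ A ⊆ Ω ∧ volume A < ⊤ ∧ ∀ x ∈ Ω, x ∉ A → w x = 0 ∧ gradient w x = 0 := by
  have hT : Tendsto (fun n : ℕ => ∫⁻ x in Ω, ‖softThreshold (1 / ((n : ℝ) + 1)) (v x) - v x‖ₑ) atTop
      (𝓝 (∫⁻ x in Ω, 0)) := by
    refine tendsto_lintegral_of_dominated_convergence' (fun x => ‖v x‖ₑ) (fun n => ?_)
      (fun n => ae_of_all _ fun x => ?_) hi.2.ne (ae_of_all _ fun x => ?_)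
    · have hc : Continuous (softThreshold (1 / ((n : ℝ) + 1))) :=
        continuous_iff_continuousAt.2 fun s => (hasDerivAt_softThreshold _ s).continuousAt
      exact ((hc.comp_aestronglyMeasurable hi.1).sub hi.1).enorm
    · exact enorm_le_iff_norm_le.2 (abs_softThreshold_sub_le_abs _ _)
    · have h0 : Tendsto (fun n : ℕ => ENNReal.ofReal (4 * (1 / ((n : ℝ) + 1)))) atTop (𝓝 0) := by
        have := ENNReal.tendsto_ofReal ((tendsto_one_div_add_atTop_nhds_zero_nat (𝕜 := ℝ)).const_mul 4)
        simpa using! this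
      refine tendsto_of_tendsto_of_tendsto_of_le_of_le tendsto_const_nhds h0
        (fun n => zero_le) (fun n => ?_)
      rw [← ofReal_norm]
      exact ENNReal.ofReal_le_ofReal (abs_softThreshold_sub_le (by positivity) _)
  rw [lintegral_zero] at hT
  obtain ⟨n, hn⟩ := (hT.eventually (ge_mem_nhds hε)).exists
  set δ : ℝ := 1 / ((n : ℝ) + 1) with hδ
  have hδ0 : 0 < δ := by positivity
  have hgr : ∀ x ∈ Ω, gradient (fun y => softThreshold δ (v y)) x =
      thresholdDeriv δ (v x) • gradient v x := fun x hx =>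
    gradient_comp_of_hasDerivAt (hasDerivAt_softThreshold δ _)
      ((hv.contDiffAt (hΩ.mem_nhds hx)).differentiableAt one_ne_zero)
  have hA : IsOpen (Ω ∩ v ⁻¹' {s | δ < |s|}) :=
    hv.continuousOn.isOpen_inter_preimage hΩ (isOpen_lt continuous_const continuous_abs)
  refine ⟨fun y => softThreshold δ (v y), Ω ∩ v ⁻¹' {s | δ < |s|}, ?_, ?_, hn, ?_, hA.measurableSet,
    inter_subset_left, ?_, fun x hx hxA => ?_⟩
  · exact (contDiff_one_of_hasDerivAt (hasDerivAt_softThreshold δ)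
      (continuous_thresholdDeriv δ)).comp_contDiffOn hv
  · refine integrableOn_gradient_comp hΩ hv hg (hasDerivAt_softThreshold δ)
      (continuous_thresholdDeriv δ) (C := 1) fun s => ?_
    rw [abs_of_nonneg (thresholdDeriv_nonneg δ s)]
    exact thresholdDeriv_le_one δ s
  · refine setLIntegral_mono' hΩ.measurableSet fun x hx => enorm_le_iff_norm_le.2 ?_
    rw [hgr x hx, norm_smul, Real.norm_of_nonneg (thresholdDeriv_nonneg _ _)]
    exact mul_le_of_le_one_left (norm_nonneg _) (thresholdDeriv_le_one _ _)
  · have h := hi.measure_norm_gt_lt_top hδ0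
    rwa [Measure.restrict_apply' hΩ.measurableSet, inter_comm] at h
  · have hvx : |v x| ≤ δ := by
      by_contra! h
      exact hxA ⟨hx, h⟩
    refine ⟨softThreshold_eq_zero hδ0 hvx, ?_⟩
    rw [hgr x hx, thresholdDeriv_eq_zero hδ0 hvx, zero_smul]

/-! ### Smoothed staircases -/

theorem isProbabilityMeasure_volume_unitAddCircle :
    IsProbabilityMeasure (volume : Measure UnitAddCircle) :=
  ⟨UnitAddCircle.measure_univ⟩

theorem volume_unitAddCircle_closedBall_le (η : ℝ) :
    volume (Metric.closedBall (0 : UnitAddCircle) η) ≤ ENNReal.ofReal (2 * η) := by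
  rw [AddCircle.volume_closedBall]
  exact ENNReal.ofReal_le_ofReal (min_le_right _ _)

theorem integral_max_zero_sub_norm_pos {η : ℝ} (hη : 0 < η) :
    0 < ∫ y : UnitAddCircle, max 0 (η - ‖y‖) := by
  have hc : Continuous fun y : UnitAddCircle => max 0 (η - ‖y‖) := by fun_prop
  exact hc.integral_pos_of_hasCompactSupport_nonneg_nonzero (HasCompactSupport.of_compactSpace _)
    (fun y => le_max_left _ _) (x := 0) (by simp [hη])

theorem exists_continuous_integral_eq_one_volume_support_le {η : ℝ} (hη : 0 < η) :
    ∃ P : UnitAddCircle → ℝ, Continuous P ∧ (∀ y, 0 ≤ P y) ∧ ∫ y, P y = 1 ∧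
      volume (Function.support P) ≤ ENNReal.ofReal (2 * η) := by
  have hpos := integral_max_zero_sub_norm_pos hη
  refine ⟨fun y => (∫ z : UnitAddCircle, max 0 (η - ‖z‖))⁻¹ * max 0 (η - ‖y‖), ?_, fun y => ?_, ?_,
    (measure_mono fun y hy => ?_).trans (volume_unitAddCircle_closedBall_le η)⟩
  · exact continuous_const.mul (continuous_const.max (continuous_const.sub continuous_norm))
  · exact mul_nonneg (inv_nonneg.2 hpos.le) (le_max_left _ _)
  · rw [integral_const_mul, inv_mul_cancel₀ hpos.ne']
  · rw [mem_closedBall_zero_iff]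
    by_contra! h
    refine hy ?_
    dsimp only
    rw [max_eq_left (show η - ‖y‖ ≤ 0 by linarith), mul_zero]

/-- The primitive of the shift by `a` of the periodic function `P`. If `P ≥ 0` has mean `1` and is
concentrated near `0`, this is a smoothed staircase whose steps are at the representatives of `a`. -/
noncomputable def staircase (P : UnitAddCircle → ℝ) (a : UnitAddCircle) (s : ℝ) : ℝ :=
  ∫ r in (0 : ℝ)..s, P (r - a)

section Staircase

variable {P : UnitAddCircle → ℝ}

theorem continuous_coe_sub (hP : Continuous P) (a : UnitAddCircle) :
    Continuous fun r : ℝ => P (r - a) :=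
  hP.comp ((AddCircle.continuous_mk' 1).sub continuous_const)

theorem hasDerivAt_staircase (hP : Continuous P) (a : UnitAddCircle) (s : ℝ) :
    HasDerivAt (staircase P a) (P (s - a)) s :=
  hasDerivAt_integral_of_continuous (continuous_coe_sub hP a) s

theorem staircase_add_one (hP : Continuous P) (h1 : ∫ y, P y = 1) (a : UnitAddCircle) (s : ℝ) :
    staircase P a (s + 1) = staircase P a s + 1 := by
  have hint := fun b c => (continuous_coe_sub hP a).intervalIntegrable (μ := volume) b c
  rw [staircase, ← intervalIntegral.integral_add_adjacent_intervals (hint 0 s) (hint s (s + 1)),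
    UnitAddCircle.intervalIntegral_preimage s fun y => P (y - a), integral_sub_right_eq_self P a, h1,
    staircase]

theorem monotone_staircase (hP : Continuous P) (h0 : ∀ y, 0 ≤ P y) (a : UnitAddCircle) :
    Monotone (staircase P a) :=
  monotone_of_deriv_nonneg (fun s => (hasDerivAt_staircase hP a s).differentiableAt) fun s => by
    rw [(hasDerivAt_staircase hP a s).deriv]
    exact h0 _

/-- The difference is periodic, and on `[0, 1]` both functions increase from `0` to `1`. -/
theorem abs_staircase_sub_le (hP : Continuous P) (h0 : ∀ y, 0 ≤ P y) (h1 : ∫ y, P y = 1)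
    (a : UnitAddCircle) (s : ℝ) : |staircase P a s - s| ≤ 1 := by
  have hper : Function.Periodic (fun s => staircase P a s - s) 1 := fun s => by
    simp only [staircase_add_one hP h1]
    ring
  obtain ⟨t, ht, hst⟩ := hper.exists_mem_Ico₀ zero_lt_one s
  change staircase P a s - s = staircase P a t - t at hst
  rw [hst]
  have hz : staircase P a 0 = 0 := by simp [staircase]
  have h2 : staircase P a 1 = 1 := by
    simpa [hz] using staircase_add_one hP h1 a 0
  have h3 := monotone_staircase hP h0 a ht.1
  have h4 := monotone_staircase hP h0 a ht.2.le
  rw [abs_le]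
  constructor <;> linarith [ht.1, ht.2]

theorem hasDerivAt_mul_staircase_div (hP : Continuous P) (a : UnitAddCircle) {δ : ℝ} (hδ : δ ≠ 0)
    (s : ℝ) : HasDerivAt (fun s => δ * staircase P a (s / δ)) (P ((s / δ : ℝ) - a)) s := by
  have h := ((hasDerivAt_staircase hP a (s / δ)).comp s
    ((hasDerivAt_id s).div_const δ)).const_mul δ
  refine h.congr_deriv ?_
  field_simp

end Staircase

/-- Averaging over all shifts of a periodic function `q` replaces `q` by its mean; some shift is at
least as good as the average. -/
theorem exists_lintegral_periodic_le {X : Type*} [MeasurableSpace X] {ν : Measure X} [SFinite ν]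
    {f : X → ℝ} (hf : AEMeasurable f ν) {q₁ q₂ : UnitAddCircle → ℝ≥0∞} (hq₁ : Measurable q₁)
    (hq₂ : Measurable q₂) {g₁ g₂ : X → ℝ≥0∞} (hg₁ : AEMeasurable g₁ ν) (hg₂ : AEMeasurable g₂ ν) :
    ∃ a : UnitAddCircle, ∫⁻ x, (q₁ (f x - a) * g₁ x + q₂ (f x - a) * g₂ x) ∂ν ≤
      (∫⁻ y, q₁ y) * (∫⁻ x, g₁ x ∂ν) + (∫⁻ y, q₂ y) * ∫⁻ x, g₂ x ∂ν := by
  have hF : AEMeasurable (fun z : UnitAddCircle × X => (f z.2 : UnitAddCircle) - z.1)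
      ((volume : Measure UnitAddCircle).prod ν) :=
    ((AddCircle.continuous_mk' 1).measurable.comp_aemeasurable hf.comp_snd).sub
      measurable_fst.aemeasurable
  have hJ : AEMeasurable (Function.uncurry fun (a : UnitAddCircle) (x : X) =>
      q₁ (f x - a) * g₁ x + q₂ (f x - a) * g₂ x) ((volume : Measure UnitAddCircle).prod ν) :=
    ((hq₁.comp_aemeasurable hF).mul hg₁.comp_snd).add ((hq₂.comp_aemeasurable hF).mul hg₂.comp_snd)
  have := isProbabilityMeasure_volume_unitAddCircle
  obtain ⟨a, ha⟩ := exists_le_lintegral hJ.lintegral_prod_right'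
  refine ⟨a, ha.trans_eq ?_⟩
  simp only [Function.uncurry_apply_pair]
  rw [lintegral_lintegral_swap hJ]
  have hm : ∀ {q : UnitAddCircle → ℝ≥0∞}, Measurable q → ∀ c : UnitAddCircle,
      Measurable fun a => q (c - a) := fun hq c => hq.comp (measurable_const.sub measurable_id)
  have h : ∀ x, ∫⁻ a : UnitAddCircle, (q₁ (f x - a) * g₁ x + q₂ (f x - a) * g₂ x) =
      (∫⁻ y, q₁ y) * g₁ x + (∫⁻ y, q₂ y) * g₂ x := fun x => by
    rw [lintegral_add_left ((hm hq₁ _).mul_const _), lintegral_mul_const _ (hm hq₁ _),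
      lintegral_mul_const _ (hm hq₂ _), lintegral_sub_left_eq_self q₁, lintegral_sub_left_eq_self q₂]
  simp_rw [h]
  rw [lintegral_add_left' (hg₁.const_mul _), lintegral_const_mul'' _ hg₁, lintegral_const_mul'' _ hg₂]

section Energy

variable {m : ℕ} {Ω : Set (EuclideanSpace ℝ (Fin m))} {v : EuclideanSpace ℝ (Fin m) → ℝ}
  {φ : ℝ → ℝ} {φinf : ℝ}

/-- The energy of a smoothed staircase composed with `v`, for a suitable shift of the steps. Where
the staircase is not flat, which happens on a small fraction of `A` for most shifts, the affine
majorant `K t + C` of `φ` is used. -/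
theorem exists_TVcSmooth_staircase_le (hΩ : IsOpen Ω) (hv : ContDiffOn ℝ 1 v Ω)
    {A : Set (EuclideanSpace ℝ (Fin m))} (hA : MeasurableSet A) (hAΩ : A ⊆ Ω)
    (hvA : ∀ x ∈ Ω, x ∉ A → v x = 0 ∧ gradient v x = 0) (hφ_zero : φ 0 = 0) {K C : ℝ}
    (hK : 0 ≤ K) (hC : 0 ≤ C) (hφ : ∀ t, 0 ≤ t → φ t ≤ K * t + C) {P : UnitAddCircle → ℝ}
    (hP : Continuous P) (h0 : ∀ y, 0 ≤ P y) (h1 : ∫ y, P y = 1) {δ : ℝ} (hδ : 0 < δ) :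
    ∃ a : UnitAddCircle, TVcSmooth φ Ω (fun x => δ * staircase P a (v x / δ)) ≤
      ENNReal.ofReal K * (∫⁻ x in Ω, ‖gradient v x‖ₑ) +
        ENNReal.ofReal C * volume (Function.support P) * volume A := by
  have hvm : AEMeasurable (fun x => v x / δ) (volume.restrict Ω) :=
    (hv.continuousOn.aemeasurable hΩ.measurableSet).div_const δ
  have hgm : AEMeasurable (fun x => ‖gradient v x‖ₑ) (volume.restrict Ω) :=
    ((continuousOn_gradient hΩ hv).aemeasurable hΩ.measurableSet).enorm
  have hS : MeasurableSet (Function.support P) := hP.measurable (measurableSet_singleton 0).compl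
  obtain ⟨a, ha⟩ := exists_lintegral_periodic_le hvm
    (q₁ := fun y => ENNReal.ofReal (P y)) (q₂ := (Function.support P).indicator 1)
    hP.measurable.ennreal_ofReal (measurable_one.indicator hS)
    (hgm.const_mul (ENNReal.ofReal K))
    (g₂ := A.indicator fun _ => ENNReal.ofReal C) (measurable_const.indicator hA).aemeasurable
  have hP1 : ∫⁻ y, ENNReal.ofReal (P y) = 1 := by
    rw [← ofReal_integral_eq_lintegral_ofReal
      (hP.integrable_of_hasCompactSupport (HasCompactSupport.of_compactSpace P)) (ae_of_all _ h0),
      h1, ENNReal.ofReal_one]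
  rw [hP1, one_mul, lintegral_const_mul'' _ hgm, lintegral_indicator_one hS,
    lintegral_indicator_const hA, Measure.restrict_apply hA, inter_eq_left.2 hAΩ] at ha
  refine ⟨a, le_trans (setLIntegral_mono' hΩ.measurableSet fun x hx => ?_)
    (ha.trans_eq (by ring))⟩
  have hg : gradient (fun x => δ * staircase P a (v x / δ)) x = P ((v x / δ : ℝ) - a) • gradient v x :=
    gradient_comp_of_hasDerivAt (hasDerivAt_mul_staircase_div hP a hδ.ne' _)
      ((hv.contDiffAt (hΩ.mem_nhds hx)).differentiableAt one_ne_zero)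
  rw [hg, norm_smul, Real.norm_of_nonneg (h0 _)]
  by_cases hP0 : P ((v x / δ : ℝ) - a) = 0
  · simp [hP0, hφ_zero]
  by_cases hxA : x ∈ A
  · rw [indicator_of_mem hxA, indicator_of_mem (by exact hP0), Pi.one_apply, one_mul]
    refine (ENNReal.ofReal_le_ofReal (hφ _ (by have := h0 ((v x / δ : ℝ) - a); positivity))).trans ?_
    rw [ENNReal.ofReal_add (by have := h0 ((v x / δ : ℝ) - a); positivity) hC,
      ENNReal.ofReal_mul hK, ENNReal.ofReal_mul (h0 _), ofReal_norm]
    exact le_of_eq (by ring)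
  · simp [(hvA x hx hxA).2, hφ_zero]

theorem exists_pos_ofReal_mul_le {I : ℝ≥0∞} (hI : I ≠ ∞) {ε : ℝ} (hε : 0 < ε) :
    ∃ r : ℝ, 0 < r ∧ ENNReal.ofReal r * I ≤ ENNReal.ofReal ε := by
  have h0 : 0 ≤ I.toReal := ENNReal.toReal_nonneg
  refine ⟨ε / (I.toReal + 1), by positivity, ?_⟩
  rw [← ENNReal.ofReal_toReal hI, ← ENNReal.ofReal_mul (by positivity), ENNReal.ofReal_toReal hI]
  refine ENNReal.ofReal_le_ofReal ?_
  rw [div_mul_eq_mul_div, div_le_iff₀ (by positivity)]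
  nlinarith

/-- Turning a function of finite total variation into a staircase with steep steps: the energy
`∫ φ(|∇w|)` only sees the slope of `φ` at infinity. -/
theorem exists_TVcSmooth_le (hΩ : IsOpen Ω) (hv : ContDiffOn ℝ 1 v Ω)
    (hg : IntegrableOn (gradient v) Ω)
    {A : Set (EuclideanSpace ℝ (Fin m))} (hA : MeasurableSet A) (hAΩ : A ⊆ Ω) (hAf : volume A < ∞)
    (hvA : ∀ x ∈ Ω, x ∉ A → v x = 0 ∧ gradient v x = 0) (hφ_nonneg : ∀ t, 0 ≤ t → 0 ≤ φ t)
    (hφ_concave : ConcaveOn ℝ (Ici 0) φ) (hφ_zero : φ 0 = 0)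
    (hφ_lim : Tendsto (fun t => φ t / t) atTop (𝓝 φinf)) (hφinf : 0 ≤ φinf) {ε : ℝ} (hε : 0 < ε) :
    ∃ w : EuclideanSpace ℝ (Fin m) → ℝ, ContDiffOn ℝ 1 w Ω ∧ IntegrableOn (gradient w) Ω ∧
      ∫⁻ x in Ω, ‖w x - v x‖ₑ ≤ ENNReal.ofReal ε ∧
      TVcSmooth φ Ω w ≤ ENNReal.ofReal φinf * (∫⁻ x in Ω, ‖gradient v x‖ₑ) +
        ENNReal.ofReal ε := by
  have hI : ∫⁻ x in Ω, ‖gradient v x‖ₑ ≠ ∞ := hg.2.ne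
  -- `ε₁` is the excess slope of the affine majorant, `η` the proportion of each step on which the
  -- staircase rises, and `δ` the height of the steps; `C` depends on `ε₁`, and `η` on `C`
  obtain ⟨ε₁, hε₁, hε₁I⟩ := exists_pos_ofReal_mul_le hI (half_pos hε)
  obtain ⟨C, hC, hφC⟩ := exists_forall_le_mul_add hφ_nonneg hφ_concave hφ_lim hφinf hε₁
  obtain ⟨η, hη, hηA⟩ := exists_pos_ofReal_mul_le
    (ENNReal.mul_ne_top (ENNReal.ofReal_ne_top (r := C)) hAf.ne) (half_pos hε)
  obtain ⟨P, hP, h0, h1, hPη⟩ := exists_continuous_integral_eq_one_volume_support_le (half_pos hη)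
  rw [mul_div_cancel₀ η two_ne_zero] at hPη
  obtain ⟨δ, hδ, hδA⟩ := exists_pos_ofReal_mul_le hAf.ne hε
  obtain ⟨a, ha⟩ := exists_TVcSmooth_staircase_le hΩ hv hA hAΩ hvA hφ_zero
    (add_nonneg hφinf hε₁.le) hC hφC hP h0 h1 hδ
  have hD := hasDerivAt_mul_staircase_div hP a hδ.ne'
  have hPc : Continuous fun s : ℝ => P ((s / δ : ℝ) - a) :=
    (continuous_coe_sub hP a).comp (continuous_id.div_const δ)
  obtain ⟨M, hM⟩ := (isCompact_range hP).isBounded.exists_norm_le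
  refine ⟨fun x => δ * staircase P a (v x / δ),
    (contDiff_one_of_hasDerivAt hD hPc).comp_contDiffOn hv,
    integrableOn_gradient_comp (H := fun s => δ * staircase P a (s / δ)) hΩ hv hg hD hPc
      fun s => hM _ (mem_range_self _), ?_, ha.trans ?_⟩
  · calc ∫⁻ x in Ω, ‖δ * staircase P a (v x / δ) - v x‖ₑ
        ≤ ∫⁻ x in Ω, A.indicator (fun _ => ENNReal.ofReal δ) x := by
          refine setLIntegral_mono' hΩ.measurableSet fun x hx => ?_
          by_cases hxA : x ∈ A
          · have h := abs_staircase_sub_le hP h0 h1 a (v x / δ)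
            have e : δ * staircase P a (v x / δ) - v x =
                δ * (staircase P a (v x / δ) - v x / δ) := by field_simp
            rw [indicator_of_mem hxA, e, ← ofReal_norm, norm_mul, Real.norm_of_nonneg hδ.le]
            exact ENNReal.ofReal_le_ofReal (mul_le_of_le_one_right hδ.le h)
          · simp [(hvA x hx hxA).1, staircase]
      _ = ENNReal.ofReal δ * volume A := by
          rw [lintegral_indicator_const hA, Measure.restrict_apply hA, inter_eq_left.2 hAΩ]
      _ ≤ ENNReal.ofReal ε := hδA
  · rw [ENNReal.ofReal_add hφinf hε₁.le, add_mul, add_assoc]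
    gcongr
    calc _ ≤ ENNReal.ofReal (ε / 2) + ENNReal.ofReal η * (ENNReal.ofReal C * volume A) := by
          refine add_le_add hε₁I ?_
          calc ENNReal.ofReal C * volume (Function.support P) * volume A
              ≤ ENNReal.ofReal C * ENNReal.ofReal η * volume A := by gcongr
            _ = _ := by ring
      _ ≤ ENNReal.ofReal (ε / 2) + ENNReal.ofReal (ε / 2) := by gcongr
      _ = ENNReal.ofReal ε := by
          rw [← ENNReal.ofReal_add (by positivity) (by positivity), add_halves]

end Energy

/-! ### Weak* convergence -/

section WeakStar

variable {m : ℕ} {Ω : Set (EuclideanSpace ℝ (Fin m))} {u : EuclideanSpace ℝ (Fin m) → ℝ}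
  {v : ℕ → EuclideanSpace ℝ (Fin m) → ℝ}

theorem isDistribGradient_distribGradient (h : IsBV Ω u) :
    IsDistribGradient Ω u (distribGradient Ω u) := by
  rw [distribGradient, dif_pos h.2]
  exact h.2.choose_spec

theorem integrableOn_of_lintegral_sub {w : EuclideanSpace ℝ (Fin m) → ℝ}
    (hw : AEStronglyMeasurable w (volume.restrict Ω)) (hu : IntegrableOn u Ω)
    (h : ∫⁻ x in Ω, ‖w x - u x‖ₑ < ∞) : IntegrableOn w Ω := by
  have h1 : Integrable (fun x => w x - u x) (volume.restrict Ω) := ⟨hw.sub hu.1, h⟩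
  exact (h1.add hu).congr (ae_of_all _ fun x => sub_add_cancel (w x) (u x))

theorem lintegral_sub_le_add {w v' : EuclideanSpace ℝ (Fin m) → ℝ}
    (hw : AEStronglyMeasurable w (volume.restrict Ω))
    (hv : AEStronglyMeasurable v' (volume.restrict Ω)) :
    ∫⁻ x in Ω, ‖w x - u x‖ₑ ≤ (∫⁻ x in Ω, ‖w x - v' x‖ₑ) + ∫⁻ x in Ω, ‖v' x - u x‖ₑ := by
  have hm : AEMeasurable (fun x => ‖w x - v' x‖ₑ) (volume.restrict Ω) := (hw.sub hv).enorm
  rw [← lintegral_add_left' hm]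
  refine lintegral_mono fun x => ?_
  rw [← sub_add_sub_cancel (w x) (v' x) (u x)]
  exact enorm_add_le _ _

theorem tendsto_integral_mul_divergence (hu : IntegrableOn u Ω) (hv : ∀ i, IntegrableOn (v i) Ω)
    (h : Tendsto (fun i => ∫⁻ x in Ω, ‖v i x - u x‖ₑ) atTop (𝓝 0))
    {ψ : EuclideanSpace ℝ (Fin m) → EuclideanSpace ℝ (Fin m)} (hψ : IsTestField Ω ψ) :
    Tendsto (fun i => ∫ x in Ω, v i x * divergence ψ x) atTop
      (𝓝 (∫ x in Ω, u x * divergence ψ x)) := by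
  have hc : Continuous (divergence ψ) :=
    continuous_divergence (hψ.contDiff.of_le (by exact_mod_cast le_top))
  obtain ⟨C, hC⟩ := (hasCompactSupport_divergence hψ.hasCompactSupport).exists_bound_of_continuous hc
  have hi : ∀ {f : EuclideanSpace ℝ (Fin m) → ℝ}, IntegrableOn f Ω →
      IntegrableOn (fun x => f x * divergence ψ x) Ω := fun hf =>
    hf.mul_bdd (c := C) hc.aestronglyMeasurable (ae_of_all _ hC)
  refine tendsto_integral_of_L1 _ (hi hu).1 (Eventually.of_forall fun i => hi (hv i)) ?_
  have h2 := ENNReal.Tendsto.const_mul (a := ENNReal.ofReal C) h (Or.inr ENNReal.ofReal_ne_top)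
  rw [mul_zero] at h2
  refine tendsto_of_tendsto_of_tendsto_of_le_of_le tendsto_const_nhds h2 (fun i => zero_le)
    fun i => ?_
  rw [← lintegral_const_mul' _ _ ENNReal.ofReal_ne_top]
  refine lintegral_mono fun x => ?_
  rw [← sub_mul, enorm_mul, mul_comm]
  gcongr
  rw [← ofReal_norm]
  exact ENNReal.ofReal_le_ofReal (hC x)

/-- Convergence in `L¹` together with a bound for the total variations gives weak* convergence of
the gradients: it suffices to test with smooth fields, which are dense in `C₀`. -/
theorem tendsto_pairing_of_variation_le (hΩ : IsOpen Ω)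
    {μ : VectorMeasure (EuclideanSpace ℝ (Fin m)) (EuclideanSpace ℝ (Fin m))}
    {ν : ℕ → VectorMeasure (EuclideanSpace ℝ (Fin m)) (EuclideanSpace ℝ (Fin m))}
    (hμ : IsDistribGradient Ω u μ) (hν : ∀ i, IsDistribGradient Ω (v i) (ν i))
    (hu : IntegrableOn u Ω) (hv : ∀ i, IntegrableOn (v i) Ω)
    (h : Tendsto (fun i => ∫⁻ x in Ω, ‖v i x - u x‖ₑ) atTop (𝓝 0)) {M : ℝ≥0∞} (hM : M ≠ ∞)
    (hνM : ∀ i, (ν i).variation Ω ≤ M)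
    {ψ : EuclideanSpace ℝ (Fin m) → EuclideanSpace ℝ (Fin m)} (hψ : Continuous ψ)
    (h0 : ∀ x, x ∉ Ω → ψ x = 0) (hlim : Tendsto ψ (cocompact (EuclideanSpace ℝ (Fin m))) (𝓝 0)) :
    Tendsto (fun i => pairing (ν i) ψ) atTop (𝓝 (pairing μ ψ)) := by
  set L : ℝ := M.toReal + (μ.variation univ).toReal with hL
  have hL0 : 0 ≤ L := by positivity
  have hνL : ∀ i, (ν i).variation.real univ ≤ L := fun i => by
    rw [measureReal_def, (hν i).variation_univ hΩ, hL]
    linarith [ENNReal.toReal_mono hM (hνM i), (μ.variation univ).toReal_nonneg]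
  have hμL : μ.variation.real univ ≤ L := by
    rw [measureReal_def, hL]
    linarith [M.toReal_nonneg]
  have hclose : ∀ {ρ : VectorMeasure (EuclideanSpace ℝ (Fin m)) (EuclideanSpace ℝ (Fin m))}
      {ψ' : EuclideanSpace ℝ (Fin m) → EuclideanSpace ℝ (Fin m)} {r : ℝ}, 0 ≤ r →
      ρ.variation univ < ∞ → ρ.variation.real univ ≤ L → IsTestField Ω ψ' →
      (∀ x, ‖ψ x - ψ' x‖ ≤ r) → |pairing ρ ψ - pairing ρ ψ'| ≤ r * L := by
    intro ρ ψ' r hr hρ hρL hψ' hr'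
    have : IsFiniteMeasure ρ.variation := ⟨hρ⟩
    obtain ⟨C, hC⟩ := hψ'.hasCompactSupport.exists_bound_of_continuous hψ'.contDiff.continuous
    have hψi : Integrable ψ ρ.variation :=
      Integrable.of_bound hψ.aestronglyMeasurable (r + C) (ae_of_all _ fun x => by
        calc ‖ψ x‖ = ‖(ψ x - ψ' x) + ψ' x‖ := by rw [sub_add_cancel]
          _ ≤ r + C := (norm_add_le _ _).trans (add_le_add (hr' x) (hC x)))
    exact (abs_pairing_sub_le hψi hψ'.integrable).trans
      ((integral_norm_le_mul_variation hr').trans (by gcongr))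
  rw [Metric.tendsto_atTop]
  intro ε hε
  obtain ⟨ψ', hψ', hr⟩ := exists_isTestField_norm_sub_le_of_tendsto hΩ hψ h0 hlim
    (show 0 < ε / (4 * (L + 1)) by positivity)
  have hrL : ε / (4 * (L + 1)) * L ≤ ε / 4 := by
    rw [div_mul_eq_mul_div, div_le_div_iff₀ (by positivity) (by positivity)]
    nlinarith
  have ht : Tendsto (fun i => pairing (ν i) ψ') atTop (𝓝 (pairing μ ψ')) := by
    have h1 := (tendsto_integral_mul_divergence hu hv h hψ').neg
    have e : ∀ {f : EuclideanSpace ℝ (Fin m) → ℝ} {ρ}, IsDistribGradient Ω f ρ →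
        -(∫ x in Ω, f x * divergence ψ' x) = pairing ρ ψ' := fun hρ => by
      rw [hρ.integral_div ψ' hψ'.contDiff hψ'.hasCompactSupport hψ'.tsupport_subset, neg_neg]
    rw [e hμ] at h1
    exact h1.congr fun i => e (hν i)
  obtain ⟨N, hN⟩ := Metric.tendsto_atTop.1 ht (ε / 4) (by positivity)
  refine ⟨N, fun i hi => ?_⟩
  have h1 := (hclose (by positivity) (hν i).finite (hνL i) hψ' hr).trans hrL
  have h2 := (hclose (by positivity) hμ.finite hμL hψ' hr).trans hrL
  have h3 := hN i hi
  rw [Real.dist_eq] at h3 ⊢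
  rw [abs_le] at h1 h2
  rw [abs_lt] at h3 ⊢
  constructor <;> linarith

end WeakStar

/-! ### The relaxed model -/

section Relaxation

variable {m : ℕ} {Ω : Set (EuclideanSpace ℝ (Fin m))} {u : EuclideanSpace ℝ (Fin m) → ℝ}
  {φ : ℝ → ℝ} {φinf : ℝ}

theorem mul_lintegral_gradient_le_TVcSmooth (hφ_concave : ConcaveOn ℝ (Ici 0) φ)
    (hφ_zero : φ 0 = 0) (hφ_lim : Tendsto (fun t => φ t / t) atTop (𝓝 φinf)) (hφinf : 0 ≤ φinf)
    (v : EuclideanSpace ℝ (Fin m) → ℝ) :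
    ENNReal.ofReal φinf * (∫⁻ x in Ω, ‖gradient v x‖ₑ) ≤ TVcSmooth φ Ω v := by
  rw [← lintegral_const_mul' _ _ ENNReal.ofReal_ne_top]
  refine lintegral_mono fun x => ?_
  rw [← ofReal_norm, ← ENNReal.ofReal_mul hφinf]
  exact ENNReal.ofReal_le_ofReal
    (mul_le_of_concaveOn_of_tendsto_div hφ_concave hφ_zero hφ_lim (norm_nonneg _))

/-- The lower bound: `φinf * TV` is below the energy and is lower semicontinuous, being a supremum
of pairings with test fields. -/
theorem mul_TV_le_liminf (hΩ : IsOpen Ω) (hφ_concave : ConcaveOn ℝ (Ici 0) φ)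
    (hφ_zero : φ 0 = 0) (hφ_lim : Tendsto (fun t => φ t / t) atTop (𝓝 φinf)) (hφinf : 0 < φinf)
    {v : ℕ → EuclideanSpace ℝ (Fin m) → ℝ} (hv : ∀ i, ContDiffOn ℝ 1 (v i) Ω)
    (hvu : WeakStarBV Ω v u) :
    ENNReal.ofReal φinf * TV Ω u ≤ liminf (fun i => TVcSmooth φ Ω (v i)) atTop := by
  have hφ0 : ENNReal.ofReal φinf ≠ 0 := by simpa using hφinf
  have hμ := isDistribGradient_distribGradient hvu.bv_lim
  have : IsFiniteMeasure (distribGradient Ω u).variation := ⟨hμ.finite⟩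
  rw [mul_comm, ← ENNReal.le_div_iff_mul_le (Or.inl hφ0) (Or.inl ENNReal.ofReal_ne_top), TV]
  refine variation_le_of_forall_isTestField hΩ hμ.concentrated fun ψ hψ hψ1 => ?_
  rw [ENNReal.le_div_iff_mul_le (Or.inl hφ0) (Or.inl ENNReal.ofReal_ne_top), mul_comm]
  have ht := hvu.tendsto_gradient ψ hψ.contDiff.continuous
    (fun _ hx => hψ.eq_zero hx) hψ.hasCompactSupport.is_zero_at_infty
  have ht2 := ENNReal.Tendsto.const_mul (a := ENNReal.ofReal φinf) (ENNReal.tendsto_ofReal ht)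
    (Or.inr ENNReal.ofReal_ne_top)
  rw [← ht2.liminf_eq]
  refine liminf_le_liminf (Eventually.of_forall fun i => ?_)
  refine le_trans ?_ (mul_lintegral_gradient_le_TVcSmooth hφ_concave hφ_zero hφ_lim hφinf.le (v i))
  gcongr
  have hd := isDistribGradient_distribGradient (hvu.bv_seq i)
  have h := hd.integral_div ψ hψ.contDiff hψ.hasCompactSupport hψ.tsupport_subset
  rw [integral_mul_divergence_eq_neg hΩ (hv i) hψ, neg_inj] at h
  rw [← h]
  exact enorm_integral_inner_le hψ1 _

/-- A recovery function: approximate by a smooth function, threshold it, and make it a staircase. -/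
theorem exists_contDiffOn_TVcSmooth_le (hΩ : IsOpen Ω) (hφ_nonneg : ∀ t, 0 ≤ t → 0 ≤ φ t)
    (hφ_concave : ConcaveOn ℝ (Ici 0) φ) (hφ_zero : φ 0 = 0)
    (hφ_lim : Tendsto (fun t => φ t / t) atTop (𝓝 φinf)) (hφinf : 0 ≤ φinf) (hu : IsBV Ω u)
    {ε : ℝ} (hε : 0 < ε) :
    ∃ w : EuclideanSpace ℝ (Fin m) → ℝ, ContDiffOn ℝ 1 w Ω ∧ IntegrableOn w Ω ∧
      IntegrableOn (gradient w) Ω ∧ ∫⁻ x in Ω, ‖w x - u x‖ₑ ≤ 3 * ENNReal.ofReal ε ∧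
      TVcSmooth φ Ω w ≤ ENNReal.ofReal φinf * (TV Ω u + ENNReal.ofReal ε) + ENNReal.ofReal ε := by
  have hμ := isDistribGradient_distribGradient hu
  obtain ⟨v₁, hv₁s, hv₁u, hv₁g⟩ := hμ.exists_contDiffOn_approx hΩ hu.1 hε
  have hv₁ : ContDiffOn ℝ 1 v₁ Ω := hv₁s.of_le (by exact_mod_cast le_top)
  have hm : ∀ {w : EuclideanSpace ℝ (Fin m) → ℝ}, ContDiffOn ℝ 1 w Ω →
      AEStronglyMeasurable w (volume.restrict Ω) := fun hw =>
    hw.continuousOn.aestronglyMeasurable hΩ.measurableSet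
  have hv₁i := integrableOn_of_lintegral_sub (hm hv₁) hu.1 (hv₁u.trans_lt ENNReal.ofReal_lt_top)
  have hTV : TV Ω u < ∞ := (measure_mono (subset_univ Ω)).trans_lt hμ.finite
  have hv₁gi : IntegrableOn (gradient v₁) Ω :=
    ⟨(continuousOn_gradient hΩ hv₁).aestronglyMeasurable hΩ.measurableSet,
      hv₁g.trans_lt (ENNReal.add_lt_top.2 ⟨hTV, ENNReal.ofReal_lt_top⟩)⟩
  obtain ⟨v₂, A, hv₂, hv₂gi, hv₂v₁, hv₂g, hA, hAΩ, hAf, hv₂A⟩ :=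
    exists_approx_finite_measure hΩ hv₁ hv₁i hv₁gi (ENNReal.ofReal_pos.2 hε)
  obtain ⟨w, hw, hwgi, hwv₂, hwφ⟩ := exists_TVcSmooth_le hΩ hv₂ hv₂gi hA hAΩ hAf hv₂A hφ_nonneg
    hφ_concave hφ_zero hφ_lim hφinf hε
  have hwu : ∫⁻ x in Ω, ‖w x - u x‖ₑ ≤ 3 * ENNReal.ofReal ε := by
    refine (lintegral_sub_le_add (hm hw) (hm hv₂)).trans ?_
    calc _ ≤ ENNReal.ofReal ε + (ENNReal.ofReal ε + ENNReal.ofReal ε) :=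
          add_le_add hwv₂ ((lintegral_sub_le_add (hm hv₂) (hm hv₁)).trans (add_le_add hv₂v₁ hv₁u))
      _ = 3 * ENNReal.ofReal ε := by ring
  refine ⟨w, hw, integrableOn_of_lintegral_sub (hm hw) hu.1 (hwu.trans_lt ?_), hwgi, hwu,
    hwφ.trans ?_⟩
  · exact ENNReal.mul_lt_top (by simp) ENNReal.ofReal_lt_top
  · gcongr
    exact hv₂g.trans hv₁g

/-- The upper bound. The recovery functions have bounded total variation because their energies
are bounded, so their convergence in `L¹` improves to weak* convergence. -/
theorem TVc_le (hΩ : IsOpen Ω) (hφ_nonneg : ∀ t, 0 ≤ t → 0 ≤ φ t)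
    (hφ_concave : ConcaveOn ℝ (Ici 0) φ) (hφ_zero : φ 0 = 0)
    (hφ_lim : Tendsto (fun t => φ t / t) atTop (𝓝 φinf)) (hφinf : 0 < φinf) (hu : IsBV Ω u) :
    TVc φ Ω u ≤ ENNReal.ofReal φinf * TV Ω u := by
  have hμ := isDistribGradient_distribGradient hu
  choose w hw hwi hwg hwu hwφ using fun n : ℕ => exists_contDiffOn_TVcSmooth_le hΩ hφ_nonneg
    hφ_concave hφ_zero hφ_lim hφinf.le hu (ε := 1 / ((n : ℝ) + 1)) (by positivity)
  have hε : Tendsto (fun n : ℕ => ENNReal.ofReal (1 / ((n : ℝ) + 1))) atTop (𝓝 0) := by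
    simpa using! ENNReal.tendsto_ofReal (tendsto_one_div_add_atTop_nhds_zero_nat (𝕜 := ℝ))
  have hwbv : ∀ n, IsBV Ω (w n) := fun n =>
    ⟨hwi n, _, isDistribGradient_withDensity hΩ (hw n) (hwg n)⟩
  have hL1 : Tendsto (fun n => ∫⁻ x in Ω, ‖w n x - u x‖ₑ) atTop (𝓝 0) := by
    have h := ENNReal.Tendsto.const_mul (a := 3) hε (Or.inr (by simp))
    rw [mul_zero] at h
    exact tendsto_of_tendsto_of_tendsto_of_le_of_le tendsto_const_nhds h (fun n => zero_le) hwu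
  have hφ0 : ENNReal.ofReal φinf ≠ 0 := by simpa using hφinf
  have hTV : TV Ω u < ∞ := (measure_mono (subset_univ Ω)).trans_lt hμ.finite
  set B : ℝ≥0∞ := ENNReal.ofReal φinf * (TV Ω u + 1) + 1 with hB
  have hBtop : B ≠ ∞ := ENNReal.add_ne_top.2
    ⟨ENNReal.mul_ne_top ENNReal.ofReal_ne_top (ENNReal.add_ne_top.2 ⟨hTV.ne, by simp⟩), by simp⟩
  have hvar : ∀ n, (distribGradient Ω (w n)).variation Ω ≤ B / ENNReal.ofReal φinf := fun n => by
    have h1 : ENNReal.ofReal (1 / ((n : ℝ) + 1)) ≤ 1 := by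
      rw [ENNReal.ofReal_le_one, div_le_one (by positivity)]
      linarith [n.cast_nonneg (α := ℝ)]
    rw [ENNReal.le_div_iff_mul_le (Or.inl hφ0) (Or.inl ENNReal.ofReal_ne_top), mul_comm]
    calc _ ≤ ENNReal.ofReal φinf * ∫⁻ x in Ω, ‖gradient (w n) x‖ₑ := by
          gcongr
          exact (isDistribGradient_distribGradient (hwbv n)).variation_le_lintegral hΩ (hw n)
      _ ≤ TVcSmooth φ Ω (w n) :=
          mul_lintegral_gradient_le_TVcSmooth hφ_concave hφ_zero hφ_lim hφinf.le _
      _ ≤ B := (hwφ n).trans (by rw [hB]; gcongr)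
  have hweak : WeakStarBV Ω w u :=
    ⟨hwbv, hu, hL1, fun ψ hψ hψ0 hψlim => tendsto_pairing_of_variation_le hΩ hμ
      (fun n => isDistribGradient_distribGradient (hwbv n)) hu.1 hwi hL1
      (ENNReal.div_ne_top hBtop hφ0) hvar hψ hψ0 hψlim⟩
  refine (iInf₂_le_of_le w hw (iInf_le _ hweak)).trans ?_
  have hlim : Tendsto (fun n : ℕ => ENNReal.ofReal φinf *
      (TV Ω u + ENNReal.ofReal (1 / ((n : ℝ) + 1))) + ENNReal.ofReal (1 / ((n : ℝ) + 1))) atTop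
      (𝓝 (ENNReal.ofReal φinf * (TV Ω u + 0) + 0)) :=
    (ENNReal.Tendsto.const_mul (tendsto_const_nhds.add hε) (Or.inr ENNReal.ofReal_ne_top)).add hε
  rw [add_zero, add_zero] at hlim
  rw [← hlim.liminf_eq]
  exact liminf_le_liminf (Eventually.of_forall hwφ)

end Relaxation

theorem theorem4p5 {m : ℕ} (φ : ℝ → ℝ) (φinf : ℝ)
    (hφ_nonneg : ∀ t, 0 ≤ t → 0 ≤ φ t)
    (hφ_concave : ConcaveOn ℝ (Set.Ici 0) φ)
    (hφ_zero : φ 0 = 0)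
    (hφ_lim : Tendsto (fun t => φ t / t) atTop (𝓝 φinf))
    (hφinf_pos : 0 < φinf)
    (Ω : Set (EuclideanSpace ℝ (Fin m))) (hΩ_open : IsOpen Ω)
    (hΩ_lip : HasLipschitzBoundary Ω) :
    ∀ u : EuclideanSpace ℝ (Fin m) → ℝ, IsBV Ω u →
      TVc φ Ω u = ENNReal.ofReal φinf * TV Ω u := fun _ hu =>
  le_antisymm (TVc_le hΩ_open hφ_nonneg hφ_concave hφ_zero hφ_lim hφinf_pos hu)
    (le_iInf fun _ => le_iInf fun hv => le_iInf fun hvu =>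
      mul_TV_le_liminf hΩ_open hφ_concave hφ_zero hφ_lim hφinf_pos hv hvu)
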